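/- Let $\mathcal C_0=\{(x,t)\in\mathbb R^3\times\mathbb R: t=|x|>0\}$ be the future null cone (without its vertex) in Minkowski space $\mathbb R^{3,1}$, with the degenerate form $ds^2_{\mathcal C_0}$ induced by the Minkowski metric, $\mathbb R^+=(0,\infty)$, and $i_r:S^2\to\mathcal C_0$, $i_r(\theta)=(r\theta,r)$; thus $(r,\theta)\in\mathbb R^+\times S^2$ are polar coordinates on $\mathcal C_0$. A smooth map $\Phi:\mathcal C_0\to\mathcal C_0$ is quasi-spherical if for every $r>0$ the map $\Phi_r=\Phi\circ i_r:S^2\to\mathcal C_0$ is an orientation preserving embedding (i.e. an embedding such that the induced map $S^2\to S^2$, $\theta\mapsto x/|x|$ with $\Phi_r(\theta)=(x,t)$, preserves orientation) with $\Phi_r^*(ds^2_{\mathcal C_0})=r^2|d\theta|^2$. For $w\in\mathbb R^3$ and $R\in SO(3)$ put $b=\sqrt{1+|w|^2}$, $W=I+\frac1{b+1}ww^T$ and $$L(w,R)=\begin{pmatrix}R&0\\0&1\end{pmatrix}\begin{pmatrix}W&w\\w^T&b\end{pmatrix};$$ $\Phi$ has parameters $(w,R)$ at $r$ if $\Phi_r=L(w,R)\circ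 i_r$. A vector field $\beta(r,\theta)$ with $\theta^T\beta=0$ is the shear vector of $\Phi$ if $\Phi^*(ds^2_{\mathcal C_0})=|r\,d\theta+\beta\,dr|^2$. Let $s_1,t_1\in C^\infty(\mathbb R^+,\mathbb R^3)$, $r_0>0$, $w_0\in\mathbb R^3$ and $R_0\in SO(3)$, and write $\Theta=I-\theta\theta^T$. Then there is a unique smooth quasi-spherical map $\Phi:\mathcal C_0\to\mathcal C_0$ that has parameters $(w_0,R_0)$ at $r_0$ and shear vector $$\beta(r,\theta)=\Theta\,t_1(r)+\theta\times s_1(r).$$ Moreover, for every $r>0$ the map $\Phi$ has unique parameters $(w(r),R(r))$ at $r$, and $w\in C^\infty(\mathbb R^+,\mathbb R^3)$, $R\in C^\infty(\mathbb R^+,SO(3))$, $w(r_0)=w_0$, $R(r_0)=R_0$. The same holds with the normalization $\beta(r,\theta)=r\,\Theta\,t_1(r)+r\,\theta\times s_1(r)$ of the shear vector. -/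

import Mathlib

open Set
open scoped ContDiff RealInnerProductSpace

noncomputable section

/-- Euclidean three-space. -/
abbrev E3 : Type := EuclideanSpace ℝ (Fin 3)

/-- The unit sphere `S²` in `E3`. -/
def S2 : Set E3 := Metric.sphere 0 1

/-- The cross product on `E3`. -/
def cross (a b : E3) : E3 := WithLp.toLp 2 (crossProduct (WithLp.ofLp a) (WithLp.ofLp b))

/-- The action of a real `3 × 3` matrix on column vectors. -/
def matAct (R : Matrix (Fin 3) (Fin 3) ℝ) (x : E3) : E3 :=
  WithLp.toLp 2 (R.mulVec (WithLp.ofLp x))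

/-- The Minkowski bilinear form on `ℝ^{3,1}`, whose points are written `(x, t)`. -/
def minkowski (p q : E3 × ℝ) : ℝ := ⟪p.1, q.1⟫ - p.2 * q.2

/-- The future null cone `t = |x|` of the origin, without its vertex. -/
def nullCone : Set (E3 × ℝ) := {p | p.2 = ‖p.1‖ ∧ 0 < p.2}

/-- The inclusion `i_r : S² → C₀`, `θ ↦ (r θ, r)`. -/
def sphereIncl (r : ℝ) (θ : E3) : E3 × ℝ := (r • θ, r)

/-- The extension, homogeneous of degree zero, of a function on `S²` to `ℝ³ ∖ {0}`. A function on
`S²` is smooth iff this extension is smooth away from the origin, and its differential at `θ ∈ S²`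
is the restriction to vectors orthogonal to `θ` of the derivative of the extension. -/
def angExt {V : Type*} (h : E3 → V) (x : E3) : V := h (‖x‖⁻¹ • x)

/-- The direction `ζ = x / |x| ∈ S²` of a point `(x, t)` of the null cone. -/
def direction (p : E3 × ℝ) : E3 := ‖p.1‖⁻¹ • p.1

/-- `g : S² → C₀` (only the values on `S²` matter) is a quasi-sphere of radius `r`: an
orientation preserving smooth embedding for which the pull-back of the form that the Minkowski
metric induces on the cone is `r² |dθ|²`. Since `S²` is compact, a smooth embedding is an
injective immersion. Orientation preserving means that the induced map
`direction ∘ g : S² → S²` preserves the orientation of `S²` given by the outer normal. -/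
structure IsQuasiSphere (r : ℝ) (g : E3 → E3 × ℝ) : Prop where
  mapsTo : MapsTo g S2 nullCone
  smooth : ContDiffOn ℝ ∞ (angExt g) {0}ᶜ
  injective : InjOn g S2
  immersion : ∀ θ ∈ S2, ∀ v : E3, ⟪θ, v⟫ = 0 → fderiv ℝ (angExt g) θ v = 0 → v = 0
  orientation : ∀ θ ∈ S2, ∀ u v : E3, ⟪θ, u⟫ = 0 → ⟪θ, v⟫ = 0 → 0 < ⟪θ, cross u v⟫ →
    0 < ⟪direction (g θ), cross (fderiv ℝ (angExt fun η => direction (g η)) θ u)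
      (fderiv ℝ (angExt fun η => direction (g η)) θ v)⟫
  isometric : ∀ θ ∈ S2, ∀ u v : E3, ⟪θ, u⟫ = 0 → ⟪θ, v⟫ = 0 →
    minkowski (fderiv ℝ (angExt g) θ u) (fderiv ℝ (angExt g) θ v) = r ^ 2 * ⟪u, v⟫

/-- The map `(r, θ) ↦ Φ(r θ, r)`, i.e. `Φ` in polar coordinates on the cone, extended from
`ℝ⁺ × S²` to `ℝ⁺ × (ℝ³ ∖ {0})` homogeneously of degree zero in the second variable. -/
def polarExt (Φ : E3 × ℝ → E3 × ℝ) (p : ℝ × E3) : E3 × ℝ :=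
  angExt (fun θ => Φ (sphereIncl p.1 θ)) p.2

/-- `Φ : C₀ → C₀` (only the values on the cone matter) is a smooth quasi-spherical map. -/
structure IsQuasiSphericalMap (Φ : E3 × ℝ → E3 × ℝ) : Prop where
  mapsTo : MapsTo Φ nullCone nullCone
  smooth : ContDiffOn ℝ ∞ (polarExt Φ) (Ioi 0 ×ˢ {0}ᶜ)
  quasiSphere : ∀ r : ℝ, 0 < r → IsQuasiSphere r fun θ => Φ (sphereIncl r θ)

/-- `β` is the shear vector of `Φ`: it is tangent to the spheres and the pull-back by `Φ` of the
form induced on the cone is `|r dθ + β dr|²`, evaluated here on the pairs of tangent vectors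
`(a, u)`, `(a', u')` at `(r, θ) ∈ ℝ⁺ × S²`. -/
def HasShear (Φ : E3 × ℝ → E3 × ℝ) (β : ℝ → E3 → E3) : Prop :=
  ∀ r : ℝ, 0 < r → ∀ θ ∈ S2, ⟪θ, β r θ⟫ = 0 ∧
    ∀ (a a' : ℝ) (u u' : E3), ⟪θ, u⟫ = 0 → ⟪θ, u'⟫ = 0 →
      minkowski (fderiv ℝ (polarExt Φ) (r, θ) (a, u)) (fderiv ℝ (polarExt Φ) (r, θ) (a', u')) =
        ⟪r • u + a • β r θ, r • u' + a' • β r θ⟫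

/-- The factor `b = √(1 + |w|²)`. -/
def boostFactor (w : E3) : ℝ := Real.sqrt (1 + ‖w‖ ^ 2)

/-- The boost with block matrix `[[W, w], [wᵀ, b]]`, where `W = I + (b + 1)⁻¹ w wᵀ`. -/
def boost (w : E3) (p : E3 × ℝ) : E3 × ℝ :=
  (p.1 + (⟪w, p.1⟫ / (boostFactor w + 1)) • w + p.2 • w, ⟪w, p.1⟫ + boostFactor w * p.2)

/-- The spatial rotation with block matrix `[[R, 0], [0, 1]]`. -/
def spaceRotation (R : Matrix (Fin 3) (Fin 3) ℝ) (p : E3 × ℝ) : E3 × ℝ := (matAct R p.1, p.2)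

/-- The restriction of `Φ` to the sphere of radius `r` is given by the Lorentz transformation
with boost parameter `w` and rotation parameter `R`. -/
def HasParametersAt (Φ : E3 × ℝ → E3 × ℝ) (r : ℝ) (w : E3) (R : Matrix (Fin 3) (Fin 3) ℝ) : Prop :=
  R ∈ Matrix.specialOrthogonalGroup (Fin 3) ℝ ∧
    ∀ θ ∈ S2, Φ (sphereIncl r θ) = spaceRotation R (boost w (sphereIncl r θ))

/-- The projection `Θ t = t - (θᵀ t) θ`. -/
def angProj (θ t : E3) : E3 := t - ⟪θ, t⟫ • θ

end

/-! For existence, look for `Φ` of the form Φ(rθ, r) = L(r)(rθ, r) with a smooth curve L(r) of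
Lorentz transformations. If every row y of L solves the linear equation y' = A(r) y, where A is
`lorentzGenerator` of a = (a₁, a₂), then transposing A gives ∂ᵣΦ = L((β, 0) + (1 + r⟨a₂, θ⟩)(θ, 1))
with β = r(Θa₂ + θ × a₁), see `IsLorentzCurve.fderiv_polarExt`. The null vector (θ, 1) spans the
degenerate direction of the cone and L is an isometry, so β is exactly the shear. The prescribed
shear thus dictates a linear ODE, with a = (s₁, t₁), or r⁻¹ times this.

Such an equation is solvable on all of ℝ⁺. Its flow preserves Minkowski products, so the rows stay
Lorentz-orthonormal; continuity preserves the signs of the time component and of the determinant.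
Then w is the spatial part of the last row and R comes from the other rows
(`exists_isLorentzCurve`).

Uniqueness needs no classification of conformal maps of S². On the cone the metric is t²|dζ|², with
ζ the direction. Along a curve with r c' = -β the pulled-back form vanishes, so ζ ∘ Φ is constant
there (`HasShear.direction_const`). These characteristics exist for all radii and carry ζ from r₀ to
every r. Once ζ is known, the isometry condition t²|dζ(u)|² = r²|u|² fixes t
(`eqOn_of_direction_eq`). -/

/-! ### Linear differential equations: global existence, uniqueness, smoothness -/

section LinearODE

variable {E : Type*} [NormedAddCommGroup E] [NormedSpace ℝ E]

/-- The radial retraction of a normed space onto the closed ball of radius `M`. -/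
noncomputable def radialRetraction (M : ℝ) (x : E) : E := (M / max M ‖x‖) • x

theorem radialRetraction_of_le {M : ℝ} (hM : 0 < M) {x : E} (hx : ‖x‖ ≤ M) :
    radialRetraction M x = x := by
  rw [radialRetraction, max_eq_left hx, div_self hM.ne', one_smul]

theorem norm_radialRetraction_le {M : ℝ} (hM : 0 < M) (x : E) :
    ‖radialRetraction M x‖ ≤ M := by
  have h0 : 0 < max M ‖x‖ := lt_max_of_lt_left hM
  rw [radialRetraction, norm_smul, Real.norm_of_nonneg (by positivity), div_mul_eq_mul_div,
    div_le_iff₀ h0]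
  exact mul_le_mul_of_nonneg_left (le_max_right _ _) hM.le

theorem norm_radialRetraction_le_norm {M : ℝ} (hM : 0 < M) (x : E) :
    ‖radialRetraction M x‖ ≤ ‖x‖ := by
  have h0 : 0 < max M ‖x‖ := lt_max_of_lt_left hM
  rw [radialRetraction, norm_smul, Real.norm_of_nonneg (by positivity)]
  exact mul_le_of_le_one_left (norm_nonneg x) ((div_le_one h0).2 (le_max_left _ _))

/-- Split the difference into the rescaled x - y and the change of the scaling factor applied to y;
each costs at most ‖x - y‖. The constant 2 is not sharp, but any Lipschitz constant serves
Picard–Lindelöf. -/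
theorem norm_radialRetraction_sub_le {M : ℝ} (hM : 0 < M) (x y : E) :
    ‖radialRetraction M x - radialRetraction M y‖ ≤ 2 * ‖x - y‖ := by
  have hx : 0 < max M ‖x‖ := lt_max_of_lt_left hM
  have hy : 0 < max M ‖y‖ := lt_max_of_lt_left hM
  have e : radialRetraction M x - radialRetraction M y =
      (M / max M ‖x‖) • (x - y) + (M / max M ‖x‖ - M / max M ‖y‖) • y := by
    simp only [radialRetraction]; module
  have h1 : ‖(M / max M ‖x‖) • (x - y)‖ ≤ ‖x - y‖ := by
    rw [norm_smul, Real.norm_of_nonneg (by positivity)]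
    exact mul_le_of_le_one_left (norm_nonneg _) ((div_le_one hx).2 (le_max_left _ _))
  have h2 : ‖(M / max M ‖x‖ - M / max M ‖y‖) • y‖ ≤ ‖x - y‖ := by
    have e2 : M / max M ‖x‖ - M / max M ‖y‖ =
        (M / max M ‖x‖) * ((max M ‖y‖ - max M ‖x‖) / max M ‖y‖) := by
      field_simp
    have h3 : |max M ‖y‖ - max M ‖x‖| ≤ ‖x - y‖ := by
      rw [max_comm M, max_comm M]
      refine (abs_max_sub_max_le_abs _ _ _).trans ?_
      rw [norm_sub_rev]
      exact abs_norm_sub_norm_le y x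
    rw [norm_smul, e2, norm_mul, norm_div (_ - _), Real.norm_of_nonneg (show 0 ≤ M / max M ‖x‖ by positivity),
      Real.norm_of_nonneg hy.le, Real.norm_eq_abs, mul_assoc, div_mul_eq_mul_div |_|]
    refine (mul_le_of_le_one_left (by positivity) ((div_le_one hx).2 (le_max_left _ _))).trans ?_
    rw [div_le_iff₀ hy]
    exact mul_le_mul h3 (le_max_right _ _) (norm_nonneg _) (norm_nonneg _)
  rw [e]
  calc _ ≤ _ := norm_add_le _ _
    _ ≤ ‖x - y‖ + ‖x - y‖ := add_le_add h1 h2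
    _ = _ := by ring

theorem norm_le_of_hasDerivWithinAt_right {z : ℝ → E} {z' : ℝ → E} {K a b : ℝ}
    (hz : ∀ t ∈ Icc a b, HasDerivWithinAt z (z' t) (Icc a b) t)
    (hK : ∀ t ∈ Icc a b, ‖z' t‖ ≤ K * ‖z t‖) {t : ℝ} (ht : t ∈ Icc a b) :
    ‖z t‖ ≤ ‖z a‖ * Real.exp (K * (t - a)) := by
  have := norm_le_gronwallBound_of_norm_deriv_right_le (f := z) (f' := z') (δ := ‖z a‖) (K := K)
    (ε := 0) (a := a) (b := b) (fun s hs => (hz s hs).continuousWithinAt)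
    (fun s hs => ((hz s ⟨hs.1, hs.2.le⟩).mono_of_mem_nhdsWithin
      (Icc_mem_nhdsGE_of_mem hs)))
    le_rfl (fun s hs => by simpa using hK s ⟨hs.1, hs.2.le⟩) t ht
  rwa [gronwallBound_ε0] at this

/-- Time reversal of the forward Grönwall estimate. -/
theorem norm_le_of_hasDerivWithinAt_left {z : ℝ → E} {z' : ℝ → E} {K a b : ℝ}
    (hz : ∀ t ∈ Icc a b, HasDerivWithinAt z (z' t) (Icc a b) t)
    (hK : ∀ t ∈ Icc a b, ‖z' t‖ ≤ K * ‖z t‖) {t : ℝ} (ht : t ∈ Icc a b) :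
    ‖z t‖ ≤ ‖z b‖ * Real.exp (K * (b - t)) := by
  have hm : ∀ s ∈ Icc (-b) (-a), -s ∈ Icc a b := fun s hs => ⟨by linarith [hs.2], by linarith [hs.1]⟩
  have := norm_le_of_hasDerivWithinAt_right (z := fun s => z (-s)) (z' := fun s => -z' (-s)) (K := K)
    (a := -b) (b := -a)
    (fun s hs => by
      simpa using! (hz (-s) (hm s hs)).scomp s (hasDerivWithinAt_neg s (Icc (-b) (-a)))
        (fun x hx => hm x hx))
    (fun s hs => by simpa using hK (-s) (hm s hs))
    (t := -t) ⟨by linarith [ht.2], by linarith [ht.1]⟩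
  simpa [add_comm, sub_eq_add_neg] using this

/-- Picard–Lindelöf confines solutions to a ball, which a linear field may leave before the interval
ends. Composing with the radial retraction makes the field bounded, so one application covers the
whole interval; Grönwall then shows that the truncation was never active. -/
theorem exists_linearODE_solution_Icc [CompleteSpace E] {A : ℝ → E →L[ℝ] E} {a b : ℝ}
    (hA : ContinuousOn A (Icc a b)) {t₀ : ℝ} (ht₀ : t₀ ∈ Icc a b) (x₀ : E) :
    ∃ z : ℝ → E, z t₀ = x₀ ∧ ∀ t ∈ Icc a b, HasDerivWithinAt z (A t (z t)) (Icc a b) t := by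
  obtain ⟨K, hK⟩ : ∃ K : ℝ, ∀ t ∈ Icc a b, ‖A t‖ ≤ K :=
    isCompact_Icc.exists_bound_of_continuousOn hA
  have hK0 : 0 ≤ K := (norm_nonneg _).trans (hK t₀ ht₀)
  have hab : 0 ≤ b - a := by linarith [ht₀.1, ht₀.2]
  -- The Grönwall bound for a solution starting at `x₀`; the `+ 1` keeps it positive when `x₀ = 0`.
  obtain ⟨M, hMdef⟩ : ∃ M : ℝ, M = (‖x₀‖ + 1) * Real.exp (K * (b - a)) := ⟨_, rfl⟩
  have hM : 0 < M := by rw [hMdef]; positivity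
  have hPL : IsPicardLindelof (fun t x => A t (radialRetraction M x)) (⟨t₀, ht₀⟩ : Icc a b) x₀
      (Real.toNNReal (K * M * (b - a))) 0 (Real.toNNReal (K * M)) (Real.toNNReal (K * 2)) := by
    refine ⟨fun t ht => ?_, fun x _ => ?_, fun t ht x _ => ?_, ?_⟩
    · refine (LipschitzWith.of_dist_le_mul fun x y => ?_).lipschitzOnWith
      rw [dist_eq_norm, dist_eq_norm, ← map_sub, Real.coe_toNNReal _ (by positivity), mul_assoc]
      exact ((A t).le_opNorm _).trans (mul_le_mul (hK t ht) (norm_radialRetraction_sub_le hM x y)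
        (norm_nonneg _) hK0)
    · exact hA.clm_apply continuousOn_const
    · rw [Real.coe_toNNReal _ (by positivity)]
      exact ((A t).le_opNorm _).trans (mul_le_mul (hK t ht) (norm_radialRetraction_le hM x)
        (norm_nonneg _) hK0)
    · rw [Real.coe_toNNReal _ (by positivity), Real.coe_toNNReal _ (by positivity), NNReal.coe_zero,
        sub_zero]
      exact mul_le_mul_of_nonneg_left (max_le (by linarith [ht₀.1]) (by linarith [ht₀.2]))
        (by positivity)
  obtain ⟨z, hz0, hz⟩ := hPL.exists_eq_forall_mem_Icc_hasDerivWithinAt₀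
  have hz0' : z t₀ = x₀ := hz0
  -- The truncated field has the same linear growth bound, so Grönwall applies before the truncation
  -- is known to be inactive.
  have hgrow : ∀ t ∈ Icc a b, ‖A t (radialRetraction M (z t))‖ ≤ K * ‖z t‖ := fun t ht =>
    ((A t).le_opNorm _).trans (mul_le_mul (hK t ht) (norm_radialRetraction_le_norm hM _)
      (norm_nonneg _) hK0)
  refine ⟨z, hz0, fun t ht => ?_⟩
  suffices h : ‖z t‖ ≤ M by
    have := hz t ht
    simp only [radialRetraction_of_le hM h] at this
    exact this
  have key : ∀ s : ℝ, s ≤ b - a → ‖x₀‖ * Real.exp (K * s) ≤ M := fun s hs => by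
    rw [hMdef]
    exact mul_le_mul (by linarith) (Real.exp_le_exp.2 (mul_le_mul_of_nonneg_left hs hK0))
      (Real.exp_pos _).le (by positivity)
  rcases le_total t₀ t with h | h
  · have hsub : Icc t₀ b ⊆ Icc a b := Icc_subset_Icc_left ht₀.1
    have := norm_le_of_hasDerivWithinAt_right (fun s hs => (hz s (hsub hs)).mono hsub)
      (fun s hs => hgrow s (hsub hs)) ⟨h, ht.2⟩
    rw [hz0'] at this
    exact this.trans (key _ (by linarith [ht.2, ht₀.1]))
  · have hsub : Icc a t₀ ⊆ Icc a b := Icc_subset_Icc_right ht₀.2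
    have := norm_le_of_hasDerivWithinAt_left (fun s hs => (hz s (hsub hs)).mono hsub)
      (fun s hs => hgrow s (hsub hs)) ⟨ht.1, h⟩
    rw [hz0'] at this
    exact this.trans (key _ (by linarith [ht.1, ht₀.2]))

theorem linearODE_solution_unique_Ioo {A : ℝ → E →L[ℝ] E} {a b : ℝ}
    (hA : ContinuousOn A (Icc a b)) {t₀ : ℝ} (ht₀ : t₀ ∈ Ioo a b) {y z : ℝ → E}
    (hy : ∀ t ∈ Ioo a b, HasDerivAt y (A t (y t)) t)
    (hz : ∀ t ∈ Ioo a b, HasDerivAt z (A t (z t)) t) (h : y t₀ = z t₀) :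
    EqOn y z (Ioo a b) := by
  obtain ⟨K, hK⟩ : ∃ K : ℝ, ∀ t ∈ Icc a b, ‖A t‖ ≤ K :=
    isCompact_Icc.exists_bound_of_continuousOn hA
  refine ODE_solution_unique_of_mem_Ioo (v := fun t x => A t x) (s := fun _ => univ)
    (K := Real.toNNReal K) (fun t ht => ?_) ht₀ (fun t ht => ⟨hy t ht, mem_univ _⟩)
    (fun t ht => ⟨hz t ht, mem_univ _⟩) h
  have hb := hK t ⟨ht.1.le, ht.2.le⟩
  refine ((A t).lipschitz.weaken ?_).lipschitzOnWith
  rw [← NNReal.coe_le_coe, Real.coe_toNNReal _ ((norm_nonneg _).trans hb)]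
  exact hb

/-- Solutions of linear equations on `ℝ⁺` exist globally. -/
theorem exists_linearODE_solution_Ioi [CompleteSpace E] {A : ℝ → E →L[ℝ] E}
    (hA : ContinuousOn A (Ioi 0))
    {t₀ : ℝ} (ht₀ : 0 < t₀) (x₀ : E) :
    ∃ z : ℝ → E, z t₀ = x₀ ∧ ∀ t, 0 < t → HasDerivAt z (A t (z t)) t := by
  have hsub : ∀ s : ℝ, 1 < s → Icc (t₀ / s) (t₀ * s) ⊆ Ioi 0 := fun s hs t ht =>
    lt_of_lt_of_le (div_pos ht₀ (by linarith)) ht.1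
  have hmem : ∀ s : ℝ, 1 < s → t₀ ∈ Ioo (t₀ / s) (t₀ * s) := fun s hs =>
    ⟨div_lt_self ht₀ hs, lt_mul_of_one_lt_right ht₀ hs⟩
  have hex : ∀ s : ℝ, ∃ z : ℝ → E, 1 < s → z t₀ = x₀ ∧
      ∀ t ∈ Ioo (t₀ / s) (t₀ * s), HasDerivAt z (A t (z t)) t := by
    intro s
    by_cases hs : 1 < s
    · obtain ⟨z, h0, hz⟩ := exists_linearODE_solution_Icc (hA.mono (hsub s hs))
        (Ioo_subset_Icc_self (hmem s hs)) x₀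
      exact ⟨z, fun _ => ⟨h0, fun t ht => (hz t (Ioo_subset_Icc_self ht)).hasDerivAt
        (Icc_mem_nhds ht.1 ht.2)⟩⟩
    · exact ⟨0, fun h => absurd h hs⟩
  choose Z hZ using hex
  have hmono : ∀ s s' : ℝ, 1 < s → s ≤ s' → Ioo (t₀ / s) (t₀ * s) ⊆ Ioo (t₀ / s') (t₀ * s') :=
    fun s s' hs hss => Ioo_subset_Ioo
      (div_le_div_of_nonneg_left ht₀.le (by linarith) hss) (mul_le_mul_of_nonneg_left hss ht₀.le)
  have hagree : ∀ s s' : ℝ, 1 < s → s ≤ s' → EqOn (Z s) (Z s') (Ioo (t₀ / s) (t₀ * s)) :=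
    fun s s' hs hss => linearODE_solution_unique_Ioo (hA.mono (hsub s hs)) (hmem s hs)
      (hZ s hs).2 (fun t ht => (hZ s' (hs.trans_le hss)).2 t (hmono s s' hs hss ht))
      ((hZ s hs).1.trans (hZ s' (hs.trans_le hss)).1.symm)
  -- Any s exceeding both t / t₀ and t₀ / t puts t in the interval (t₀ / s, t₀ s); `σ t` is such a
  -- choice, and solutions on nested intervals agree.
  let σ : ℝ → ℝ := fun t => 1 + t / t₀ + t₀ / t
  have hσ : ∀ t, 0 < t → 1 < σ t := fun t ht => by
    have : 0 < t / t₀ := by positivity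
    have : 0 < t₀ / t := by positivity
    simp only [σ]; linarith
  have hσm : ∀ t, 0 < t → t ∈ Ioo (t₀ / σ t) (t₀ * σ t) := fun t ht => by
    have h1 : 0 < t / t₀ := by positivity
    have h2 : 0 < t₀ / t := by positivity
    have h3 := hσ t ht
    constructor
    · rw [div_lt_iff₀ (by linarith)]
      have : t * (t₀ / t) = t₀ := by field_simp
      simp only [σ]; nlinarith
    · have : t₀ * (t / t₀) = t := by field_simp
      simp only [σ]; nlinarith
  have hval : ∀ s t, 1 < s → 0 < t → t ∈ Ioo (t₀ / s) (t₀ * s) → Z (σ t) t = Z s t := by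
    intro s t hs ht hts
    rcases le_total s (σ t) with h | h
    · exact (hagree s (σ t) hs h hts).symm
    · exact hagree (σ t) s (hσ t ht) h (hσm t ht)
  refine ⟨fun t => Z (σ t) t, (hZ _ (hσ t₀ ht₀)).1, fun t ht => ?_⟩
  refine ((hZ _ (hσ t ht)).2 t (hσm t ht)).congr_of_eventuallyEq ?_
  filter_upwards [Ioo_mem_nhds (hσm t ht).1 (hσm t ht).2, Ioi_mem_nhds ht] with s hs hs0
  exact hval _ _ (hσ t ht) hs0 hs

/-- Bootstrapping: if z is Cⁿ, then so is z' = A z, hence z is Cⁿ⁺¹. -/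
theorem contDiffOn_of_linearODE {A : ℝ → E →L[ℝ] E} {s : Set ℝ} (hs : IsOpen s)
    (hA : ContDiffOn ℝ ∞ A s) {z : ℝ → E} (hz : ∀ t ∈ s, HasDerivAt z (A t (z t)) t) :
    ContDiffOn ℝ ∞ z s := by
  refine contDiffOn_infty.2 fun n => ?_
  induction n with
  | zero => exact contDiffOn_zero.2 fun t ht => (hz t ht).continuousAt.continuousWithinAt
  | succ n ih =>
    push_cast
    rw [contDiffOn_succ_iff_deriv_of_isOpen hs]
    refine ⟨fun t ht => (hz t ht).differentiableAt.differentiableWithinAt, by simp, ?_⟩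
    exact ((hA.of_le (by exact_mod_cast le_top)).clm_apply ih).congr fun t ht => (hz t ht).deriv

end LinearODE

/-! ### Cross products, rotations, boosts and Lorentz transformations -/

section Algebra

theorem inner_E3 (a b : E3) : ⟪a, b⟫ = a 0 * b 0 + a 1 * b 1 + a 2 * b 2 := by
  simp [PiLp.inner_apply, Fin.sum_univ_three]; ring

theorem cross_zero (a b : E3) : cross a b 0 = a 1 * b 2 - a 2 * b 1 := by
  simp [cross, cross_apply]

theorem cross_one (a b : E3) : cross a b 1 = a 2 * b 0 - a 0 * b 2 := by
  simp [cross, cross_apply]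

theorem cross_two (a b : E3) : cross a b 2 = a 0 * b 1 - a 1 * b 0 := by
  simp [cross, cross_apply]

theorem matAct_apply (R : Matrix (Fin 3) (Fin 3) ℝ) (x : E3) (i : Fin 3) :
    matAct R x i = R i 0 * x 0 + R i 1 * x 1 + R i 2 * x 2 := by
  simp [matAct, Matrix.mulVec, dotProduct, Fin.sum_univ_three]

theorem ext_E3 {a b : E3} (h0 : a 0 = b 0) (h1 : a 1 = b 1) (h2 : a 2 = b 2) : a = b := by
  ext i; fin_cases i <;> assumption

theorem cross_add_left (a b c : E3) : cross (a + b) c = cross a c + cross b c := by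
  simp [cross]

theorem cross_add_right (a b c : E3) : cross a (b + c) = cross a b + cross a c := by
  simp [cross]

theorem cross_smul_left (k : ℝ) (a b : E3) : cross (k • a) b = k • cross a b := by
  simp [cross]

theorem cross_smul_right (k : ℝ) (a b : E3) : cross a (k • b) = k • cross a b := by
  simp [cross]

theorem inner_cross_self_left (a b : E3) : ⟪a, cross a b⟫ = 0 := by
  simp only [inner_E3, cross_zero, cross_one, cross_two]; ring

/-- Two vectors orthogonal to a unit vector have their cross product along it. -/
theorem cross_eq_smul_of_orthogonal {θ u v : E3} (hθ : ‖θ‖ = 1) (hu : ⟪θ, u⟫ = 0)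
    (hv : ⟪θ, v⟫ = 0) : cross u v = ⟪θ, cross u v⟫ • θ := by
  have h1 : θ 0 * θ 0 + θ 1 * θ 1 + θ 2 * θ 2 = 1 := by
    rw [← inner_E3, real_inner_self_eq_norm_sq, hθ, one_pow]
  rw [inner_E3] at hu hv
  refine ext_E3 ?_ ?_ ?_ <;>
    simp only [inner_E3, cross_zero, cross_one, cross_two, PiLp.smul_apply, smul_eq_mul]
  · linear_combination (- (u 1 * v 2 - u 2 * v 1)) * h1 + (v 2 * θ 1 - v 1 * θ 2) * hu
      - (u 2 * θ 1 - u 1 * θ 2) * hv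
  · linear_combination (- (u 2 * v 0 - u 0 * v 2)) * h1 + (v 0 * θ 2 - v 2 * θ 0) * hu
      - (u 0 * θ 2 - u 2 * θ 0) * hv
  · linear_combination (- (u 0 * v 1 - u 1 * v 0)) * h1 + (v 1 * θ 0 - v 0 * θ 1) * hu
      - (u 1 * θ 0 - u 0 * θ 1) * hv

theorem norm_eq_one_of_mem_S2 {θ : E3} (hθ : θ ∈ S2) : ‖θ‖ = 1 := by
  simpa [S2] using hθ

theorem mem_S2_of_norm {θ : E3} (hθ : ‖θ‖ = 1) : θ ∈ S2 := by
  simpa [S2] using hθ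

theorem matAct_add (R : Matrix (Fin 3) (Fin 3) ℝ) (x y : E3) :
    matAct R (x + y) = matAct R x + matAct R y := by
  simp [matAct, Matrix.mulVec_add]

theorem matAct_smul (R : Matrix (Fin 3) (Fin 3) ℝ) (k : ℝ) (x : E3) :
    matAct R (k • x) = k • matAct R x := by
  simp [matAct, Matrix.mulVec_smul]

theorem matrix_eq_of_matAct_eq {R R' : Matrix (Fin 3) (Fin 3) ℝ}
    (h : ∀ θ ∈ S2, matAct R θ = matAct R' θ) : R = R' := by
  ext i j
  have := congrArg (fun x : E3 => x i) (h (EuclideanSpace.single j 1) (mem_S2_of_norm (by simp)))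
  simpa [matAct] using this

theorem inner_matAct {R : Matrix (Fin 3) (Fin 3) ℝ}
    (hR : R ∈ Matrix.specialOrthogonalGroup (Fin 3) ℝ) (x y : E3) :
    ⟪matAct R x, matAct R y⟫ = ⟪x, y⟫ := by
  have h : R.transpose * R = 1 :=
    (Matrix.mem_orthogonalGroup_iff' _ _).1 (Matrix.mem_specialOrthogonalGroup_iff.1 hR).1
  have e : ∀ i j, R 0 i * R 0 j + R 1 i * R 1 j + R 2 i * R 2 j = (1 : Matrix _ _ ℝ) i j := by
    intro i j
    rw [← h, Matrix.mul_apply, Fin.sum_univ_three]; rfl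
  have e00 := e 0 0
  have e01 := e 0 1
  have e02 := e 0 2
  have e11 := e 1 1
  have e12 := e 1 2
  have e22 := e 2 2
  simp at e00 e01 e02 e11 e12 e22
  simp only [inner_E3, matAct_apply]
  linear_combination (x 0 * y 0) * e00 + (x 1 * y 1) * e11 + (x 2 * y 2) * e22
    + (x 0 * y 1 + x 1 * y 0) * e01 + (x 0 * y 2 + x 2 * y 0) * e02 + (x 1 * y 2 + x 2 * y 1) * e12

theorem triple_matAct (R : Matrix (Fin 3) (Fin 3) ℝ) (x y z : E3) :
    ⟪matAct R x, cross (matAct R y) (matAct R z)⟫ = R.det * ⟪x, cross y z⟫ := by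
  simp only [inner_E3, cross_zero, cross_one, cross_two, matAct_apply, Matrix.det_fin_three]
  ring

theorem one_le_boostFactor (w : E3) : 1 ≤ boostFactor w :=
  Real.one_le_sqrt.2 (by nlinarith [norm_nonneg w])

theorem boostFactor_sq (w : E3) : boostFactor w ^ 2 = 1 + ‖w‖ ^ 2 :=
  Real.sq_sqrt (by positivity)

theorem inner_self_eq_boostFactor (w : E3) : ⟪w, w⟫ = boostFactor w ^ 2 - 1 := by
  rw [boostFactor_sq, real_inner_self_eq_norm_sq]; ring

theorem abs_inner_lt_boostFactor {θ : E3} (hθ : ‖θ‖ ≤ 1) (w : E3) : |⟪w, θ⟫| < boostFactor w := by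
  have h1 : |⟪w, θ⟫| ≤ ‖w‖ := (abs_real_inner_le_norm w θ).trans
    (mul_le_of_le_one_right (norm_nonneg w) hθ)
  refine h1.trans_lt ?_
  exact Real.lt_sqrt_of_sq_lt (by linarith)

theorem minkowski_boost (w : E3) (p q : E3 × ℝ) :
    minkowski (boost w p) (boost w q) = minkowski p q := by
  have hb : boostFactor w + 1 ≠ 0 := by linarith [one_le_boostFactor w]
  have h := inner_self_eq_boostFactor w
  simp only [minkowski, boost, inner_add_left, inner_add_right, real_inner_smul_left,
    real_inner_smul_right, h, real_inner_comm w]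
  field_simp
  ring

theorem minkowski_spaceRotation {R : Matrix (Fin 3) (Fin 3) ℝ}
    (hR : R ∈ Matrix.specialOrthogonalGroup (Fin 3) ℝ) (p q : E3 × ℝ) :
    minkowski (spaceRotation R p) (spaceRotation R q) = minkowski p q := by
  simp [minkowski, spaceRotation, inner_matAct hR]

/-- The Lorentz transformation with boost parameter `w` and rotation parameter `R`, as a linear
map. -/
noncomputable def lorentz (w : E3) (R : Matrix (Fin 3) (Fin 3) ℝ) : E3 × ℝ →ₗ[ℝ] E3 × ℝ where
  toFun p := spaceRotation R (boost w p)
  map_add' p q := by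
    simp only [spaceRotation, boost, Prod.fst_add, Prod.snd_add, inner_add_right, Prod.mk_add_mk,
      ← matAct_add]
    refine congrArg₂ Prod.mk (congrArg _ ?_) ?_
    · module
    · ring
  map_smul' k p := by
    simp only [spaceRotation, boost, Prod.smul_fst, Prod.smul_snd, real_inner_smul_right,
      Prod.smul_mk, ← matAct_smul, smul_eq_mul, RingHom.id_apply]
    refine congrArg₂ Prod.mk (congrArg _ ?_) ?_
    · module
    · ring

theorem lorentz_apply (w : E3) (R : Matrix (Fin 3) (Fin 3) ℝ) (p : E3 × ℝ) :
    lorentz w R p = spaceRotation R (boost w p) := rfl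

theorem minkowski_lorentz (w : E3) {R : Matrix (Fin 3) (Fin 3) ℝ}
    (hR : R ∈ Matrix.specialOrthogonalGroup (Fin 3) ℝ) (p q : E3 × ℝ) :
    minkowski (lorentz w R p) (lorentz w R q) = minkowski p q := by
  rw [lorentz_apply, lorentz_apply, minkowski_spaceRotation hR, minkowski_boost]

theorem eq_zero_of_minkowski {p : E3 × ℝ} (h : ∀ q, minkowski p q = 0) : p = 0 := by
  have h1 := h (p.1, 0)
  have h2 := h (0, p.2)
  simp only [minkowski, mul_zero, sub_zero, inner_self_eq_zero] at h1
  simp only [minkowski, inner_zero_right, zero_sub, neg_eq_zero, mul_self_eq_zero] at h2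
  exact Prod.ext h1 h2

/-- A vector in the kernel is orthogonal to everything, because the form is preserved; the form is
nondegenerate. -/
theorem lorentz_injective (w : E3) {R : Matrix (Fin 3) (Fin 3) ℝ}
    (hR : R ∈ Matrix.specialOrthogonalGroup (Fin 3) ℝ) : Function.Injective (lorentz w R) := by
  refine (injective_iff_map_eq_zero _).2 fun p hp => eq_zero_of_minkowski fun q => ?_
  rw [← minkowski_lorentz w hR, hp]
  simp [minkowski]

theorem mem_nullCone_iff_minkowski {p : E3 × ℝ} :
    p ∈ nullCone ↔ minkowski p p = 0 ∧ 0 < p.2 := by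
  refine and_congr_left fun h => ?_
  rw [minkowski, real_inner_self_eq_norm_sq, sub_eq_zero, ← pow_two,
    sq_eq_sq₀ (norm_nonneg _) h.le, eq_comm]

theorem sphereIncl_mem_nullCone {r : ℝ} (hr : 0 < r) {θ : E3} (hθ : θ ∈ S2) :
    sphereIncl r θ ∈ nullCone := by
  refine ⟨?_, hr⟩
  simp [sphereIncl, norm_smul, norm_eq_one_of_mem_S2 hθ, abs_of_pos hr]

theorem exists_sphereIncl_of_mem_nullCone {p : E3 × ℝ} (hp : p ∈ nullCone) :
    0 < p.2 ∧ p.2⁻¹ • p.1 ∈ S2 ∧ sphereIncl p.2 (p.2⁻¹ • p.1) = p := by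
  refine ⟨hp.2, mem_S2_of_norm ?_, ?_⟩
  · rw [norm_smul, norm_inv, Real.norm_of_nonneg hp.2.le, ← hp.1, inv_mul_cancel₀ hp.2.ne']
  · rw [sphereIncl, smul_inv_smul₀ hp.2.ne']

theorem lorentz_mem_nullCone (w : E3) {R : Matrix (Fin 3) (Fin 3) ℝ}
    (hR : R ∈ Matrix.specialOrthogonalGroup (Fin 3) ℝ) {p : E3 × ℝ} (hp : p ∈ nullCone) :
    lorentz w R p ∈ nullCone := by
  refine mem_nullCone_iff_minkowski.2 ⟨?_, ?_⟩
  · rw [minkowski_lorentz w hR, (mem_nullCone_iff_minkowski.1 hp).1]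
  · obtain ⟨h0, h1, h2⟩ := exists_sphereIncl_of_mem_nullCone hp
    rw [← h2]
    have := (abs_lt.1 (abs_inner_lt_boostFactor (norm_eq_one_of_mem_S2 h1).le w)).1
    simp only [lorentz_apply, spaceRotation, boost, sphereIncl, real_inner_smul_right]
    simp only [real_inner_smul_right] at this
    nlinarith

/-- The parameters of a Lorentz transformation are determined by its values on a sphere. -/
theorem lorentz_parameters_unique {r : ℝ} (hr : 0 < r) {w w' : E3}
    {R R' : Matrix (Fin 3) (Fin 3) ℝ}
    (h : ∀ θ ∈ S2, lorentz w R (sphereIncl r θ) = lorentz w' R' (sphereIncl r θ)) :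
    w = w' ∧ R = R' := by
  have hneg : ∀ θ ∈ S2, -θ ∈ S2 := fun θ hθ => mem_S2_of_norm
    (by rw [norm_neg, norm_eq_one_of_mem_S2 hθ])
  have key : ∀ θ ∈ S2, lorentz w R (θ, 0) = lorentz w' R' (θ, 0) := by
    intro θ hθ
    -- Antipodal points isolate the spatial vectors, on which the time component of the image is ⟨w,
    -- θ⟩; this determines w.
    have e : (θ, (0 : ℝ)) = (2 * r)⁻¹ • (sphereIncl r θ - sphereIncl r (-θ)) := by
      ext1
      · have h2r : (2 * r)⁻¹ * (2 * r) = 1 := inv_mul_cancel₀ (by positivity)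
        simp only [sphereIncl, Prod.smul_fst, Prod.fst_sub]
        rw [smul_neg, sub_neg_eq_add, ← two_smul ℝ, smul_smul, smul_smul, mul_assoc, h2r, one_smul]
      · simp [sphereIncl]
    rw [e, map_smul, map_sub, map_smul, map_sub, h θ hθ, h _ (hneg θ hθ)]
  have hw : w = w' := by
    have h2 : ∀ θ ∈ S2, ⟪w, θ⟫ = ⟪w', θ⟫ := fun θ hθ => by
      simpa [lorentz_apply, spaceRotation, boost] using congrArg Prod.snd (key θ hθ)
    ext i
    have := h2 (EuclideanSpace.single i 1) (mem_S2_of_norm (by simp))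
    simpa [EuclideanSpace.inner_single_right] using this
  subst hw
  refine ⟨rfl, matrix_eq_of_matAct_eq fun θ hθ => ?_⟩
  have hb : boostFactor w + 1 ≠ 0 := by linarith [one_le_boostFactor w]
  have h1 : ∀ η ∈ S2, matAct R η + (⟪w, η⟫ / (boostFactor w + 1)) • matAct R w =
      matAct R' η + (⟪w, η⟫ / (boostFactor w + 1)) • matAct R' w := fun η hη => by
    simpa [lorentz_apply, spaceRotation, boost, matAct_add, matAct_smul]
      using congrArg Prod.fst (key η hη)
  -- On the axis w / |w| the boost is a dilation by a positive factor, which can be cancelled.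
  have h2 : matAct R w = matAct R' w := by
    by_cases hw : w = 0
    · simp [hw, matAct]
    have hw' : ‖w‖ ≠ 0 := norm_ne_zero_iff.2 hw
    have h3 := h1 (‖w‖⁻¹ • w) (mem_S2_of_norm (by
      rw [norm_smul, norm_inv, norm_norm, inv_mul_cancel₀ hw']))
    rw [matAct_smul, matAct_smul, ← add_smul, ← add_smul] at h3
    refine smul_right_injective _ (ne_of_gt ?_) h3
    have : 0 ≤ ⟪w, ‖w‖⁻¹ • w⟫ := by
      rw [real_inner_smul_right, real_inner_self_eq_norm_sq]; positivity
    have : 0 < boostFactor w + 1 := by linarith [one_le_boostFactor w]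
    positivity
  have h3 := h1 θ hθ
  rwa [h2, add_left_inj] at h3

/-- Up to a positive factor, a boost preserves the orientation of the celestial sphere. -/
theorem triple_boost_pos (w : E3) {θ u v : E3} (hθ : θ ∈ S2) (hu : ⟪θ, u⟫ = 0) (hv : ⟪θ, v⟫ = 0)
    (h : 0 < ⟪θ, cross u v⟫) :
    0 < ⟪(boost w (θ, 1)).1, cross (boost w (u, 0)).1 (boost w (v, 0)).1⟫ := by
  have hn := norm_eq_one_of_mem_S2 hθ
  have hb : boostFactor w + 1 ≠ 0 := by linarith [one_le_boostFactor w]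
  have hw : w 0 * w 0 + w 1 * w 1 + w 2 * w 2 = boostFactor w ^ 2 - 1 := by
    rw [← inner_E3, inner_self_eq_boostFactor]
  have e : ⟪(boost w (θ, 1)).1, cross (boost w (u, 0)).1 (boost w (v, 0)).1⟫ =
      boostFactor w * ⟪θ, cross u v⟫ + ⟪w, cross u v⟫ := by
    obtain ⟨c, hc⟩ : ∃ c : ℝ, c = (boostFactor w + 1)⁻¹ := ⟨_, rfl⟩
    -- Since |w|² = b² - 1, writing b in terms of c = 1 / (b + 1) turns the triple product into a
    -- polynomial identity.
    have hD : boostFactor w = 1 + c * (w 0 * w 0 + w 1 * w 1 + w 2 * w 2) := by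
      rw [hw, hc]; field_simp; ring
    have h1 : ⟪(boost w (θ, 1)).1, cross (boost w (u, 0)).1 (boost w (v, 0)).1⟫ =
      (1 + c * (w 0 * w 0 + w 1 * w 1 + w 2 * w 2)) * ⟪θ, cross u v⟫ + ⟪w, cross u v⟫ := by
      simp only [boost, div_eq_mul_inv, ← hc, inner_E3, cross_zero, cross_one, cross_two,
        PiLp.add_apply, PiLp.smul_apply, smul_eq_mul]
      ring
    rw [h1, ← hD]
  -- As u × v is a multiple of θ, the triple product becomes (b + ⟨w, θ⟩)⟨θ, u × v⟩, and |⟨w, θ⟩| <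
  -- b.
  have h2 : ⟪w, cross u v⟫ = ⟪θ, cross u v⟫ * ⟪w, θ⟫ := by
    conv_lhs => rw [cross_eq_smul_of_orthogonal hn hu hv, real_inner_smul_right]
  rw [e, h2]
  have := (abs_lt.1 (abs_inner_lt_boostFactor hn.le w)).1
  nlinarith

theorem triple_lorentz_pos (w : E3) {R : Matrix (Fin 3) (Fin 3) ℝ}
    (hR : R ∈ Matrix.specialOrthogonalGroup (Fin 3) ℝ) {θ u v : E3} (hθ : θ ∈ S2)
    (hu : ⟪θ, u⟫ = 0) (hv : ⟪θ, v⟫ = 0) (h : 0 < ⟪θ, cross u v⟫) :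
    0 < ⟪(lorentz w R (θ, 1)).1, cross (lorentz w R (u, 0)).1 (lorentz w R (v, 0)).1⟫ := by
  simp only [lorentz_apply, spaceRotation]
  rw [triple_matAct, (Matrix.mem_specialOrthogonalGroup_iff.1 hR).2, one_mul]
  exact triple_boost_pos w hθ hu hv h

end Algebra

/-! ### Curves of Lorentz transformations with prescribed generator -/

section Frame

/-- The Euclidean pairing on `ℝ³ × ℝ`. -/
noncomputable def pairing (z p : E3 × ℝ) : ℝ := ⟪z.1, p.1⟫ + z.2 * p.2

theorem hasDerivAt_pairing {z p : ℝ → E3 × ℝ} {z' p' : E3 × ℝ} {t : ℝ}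
    (hz : HasDerivAt z z' t) (hp : HasDerivAt p p' t) :
    HasDerivAt (fun s => pairing (z s) (p s)) (pairing z' (p t) + pairing (z t) p') t := by
  have hz1 := (hasFDerivAt_fst (𝕜 := ℝ) (p := z t)).comp_hasDerivAt t hz
  have hz2 := (hasFDerivAt_snd (𝕜 := ℝ) (p := z t)).comp_hasDerivAt t hz
  have hp1 := (hasFDerivAt_fst (𝕜 := ℝ) (p := p t)).comp_hasDerivAt t hp
  have hp2 := (hasFDerivAt_snd (𝕜 := ℝ) (p := p t)).comp_hasDerivAt t hp
  refine ((hz1.inner ℝ hp1).add (hz2.mul hp2)).congr_deriv ?_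
  simp only [pairing, Function.comp, ContinuousLinearMap.coe_fst', ContinuousLinearMap.coe_snd']
  ring

theorem hasDerivAt_minkowski {z p : ℝ → E3 × ℝ} {z' p' : E3 × ℝ} {t : ℝ}
    (hz : HasDerivAt z z' t) (hp : HasDerivAt p p' t) :
    HasDerivAt (fun s => minkowski (z s) (p s)) (minkowski z' (p t) + minkowski (z t) p') t := by
  have hz1 := (hasFDerivAt_fst (𝕜 := ℝ) (p := z t)).comp_hasDerivAt t hz
  have hz2 := (hasFDerivAt_snd (𝕜 := ℝ) (p := z t)).comp_hasDerivAt t hz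
  have hp1 := (hasFDerivAt_fst (𝕜 := ℝ) (p := p t)).comp_hasDerivAt t hp
  have hp2 := (hasFDerivAt_snd (𝕜 := ℝ) (p := p t)).comp_hasDerivAt t hp
  refine ((hz1.inner ℝ hp1).sub (hz2.mul hp2)).congr_deriv ?_
  simp only [minkowski, Function.comp, ContinuousLinearMap.coe_fst', ContinuousLinearMap.coe_snd']
  ring

/-- The infinitesimal Lorentz transformation with rotation vector `a.1` and boost vector `a.2`. -/
noncomputable def lorentzGenerator : E3 × E3 →ₗ[ℝ] E3 × ℝ →ₗ[ℝ] E3 × ℝ :=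
  LinearMap.mk₂ ℝ (fun a p => (cross a.1 p.1 + p.2 • a.2, ⟪a.2, p.1⟫))
    (fun a b p => Prod.ext (by simp [cross_add_left]; abel) (by simp [inner_add_left]))
    (fun k a p => Prod.ext (by simp [cross_smul_left, smul_comm k p.2])
      (by simp [real_inner_smul_left]))
    (fun a p q => Prod.ext (by simp [cross_add_right, add_smul]; abel) (by simp [inner_add_right]))
    (fun k a p => Prod.ext (by simp [cross_smul_right, mul_smul]) (by simp [real_inner_smul_right]))

theorem lorentzGenerator_apply (a : E3 × E3) (p : E3 × ℝ) :
    lorentzGenerator a p = (cross a.1 p.1 + p.2 • a.2, ⟪a.2, p.1⟫) := rfl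

/-- Infinitesimal invariance of the form: it makes Minkowski products of solutions constants of the
motion. -/
theorem minkowski_lorentzGenerator (a : E3 × E3) (p q : E3 × ℝ) :
    minkowski (lorentzGenerator a p) q + minkowski p (lorentzGenerator a q) = 0 := by
  simp only [minkowski, lorentzGenerator_apply, inner_E3, PiLp.add_apply, PiLp.smul_apply,
    cross_zero, cross_one, cross_two, smul_eq_mul]
  ring

theorem eq_of_hasDerivAt_zero {E : Type*} [NormedAddCommGroup E] [NormedSpace ℝ E] {f : ℝ → E}
    (hf : ∀ t, 0 < t → HasDerivAt f 0 t) {s t : ℝ}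
    (hs : 0 < s) (ht : 0 < t) : f s = f t :=
  (convex_Ioi (0 : ℝ)).is_const_of_fderivWithin_eq_zero
    (fun x hx => (hf x hx).differentiableAt.differentiableWithinAt)
    (fun x hx => by
      have := (hf x hx).hasFDerivAt.hasFDerivWithinAt (s := Ioi 0)
      rw [this.fderivWithin (isOpen_Ioi.uniqueDiffWithinAt hx)]
      ext; simp) hs ht

theorem minkowski_const_of_lorentzGenerator {a : ℝ → E3 × E3} {y z : ℝ → E3 × ℝ}
    (hy : ∀ t, 0 < t → HasDerivAt y (lorentzGenerator (a t) (y t)) t)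
    (hz : ∀ t, 0 < t → HasDerivAt z (lorentzGenerator (a t) (z t)) t) {s t : ℝ} (hs : 0 < s)
    (ht : 0 < t) : minkowski (y s) (z s) = minkowski (y t) (z t) :=
  eq_of_hasDerivAt_zero (f := fun t => minkowski (y t) (z t)) (fun t ht =>
    (hasDerivAt_minkowski (hy t ht) (hz t ht)).congr_deriv (minkowski_lorentzGenerator _ _ _)) hs ht

theorem exists_lorentzGenerator_solution {a : ℝ → E3 × E3} (ha : ContDiffOn ℝ ∞ a (Ioi 0))
    {t₀ : ℝ} (ht₀ : 0 < t₀) (x₀ : E3 × ℝ) :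
    ∃ z : ℝ → E3 × ℝ, z t₀ = x₀ ∧ ContDiffOn ℝ ∞ z (Ioi 0) ∧
      ∀ t, 0 < t → HasDerivAt z (lorentzGenerator (a t) (z t)) t := by
  have hA : ContDiffOn ℝ ∞ (fun t => lorentzGenerator.toContinuousBilinearMap (a t)) (Ioi 0) :=
    (ContinuousLinearMap.contDiff _).comp_contDiffOn ha
  obtain ⟨z, h0, hz⟩ := exists_linearODE_solution_Ioi hA.continuousOn ht₀ x₀
  exact ⟨z, h0, contDiffOn_of_linearODE isOpen_Ioi hA hz, hz⟩

theorem pos_of_continuousOn_ne_zero {f : ℝ → ℝ} (hf : ContinuousOn f (Ioi 0))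
    (h : ∀ t, 0 < t → f t ≠ 0) {t₀ : ℝ} (ht₀ : 0 < t₀) (h₀ : 0 < f t₀) {t : ℝ} (ht : 0 < t) :
    0 < f t := by
  by_contra hn
  obtain ⟨s, hs, hs0⟩ := (isPreconnected_Ioi.intermediate_value (mem_Ioi.2 ht) (mem_Ioi.2 ht₀) hf)
    ⟨not_lt.1 hn, h₀.le⟩
  exact h s hs hs0

/-- The row of the rotation part of the Lorentz matrix with last row `q` and another row `z`. -/
noncomputable def rotationRow (q z : E3 × ℝ) : E3 := z.1 - (z.2 / (q.2 + 1)) • q.1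

theorem inner_self_of_minkowski {q : E3 × ℝ} (hq : minkowski q q = -1) :
    ⟪q.1, q.1⟫ = q.2 ^ 2 - 1 := by
  rw [minkowski] at hq; linarith

theorem snd_eq_boostFactor {q : E3 × ℝ} (hq : minkowski q q = -1) (hq0 : 0 < q.2) :
    q.2 = boostFactor q.1 := by
  rw [boostFactor, ← real_inner_self_eq_norm_sq, inner_self_of_minkowski hq, add_sub_cancel,
    Real.sqrt_sq hq0.le]

/-- With ⟨z, q⟩ = z₂q₂ and |q₁|² = q₂² - 1, the correction terms add up to -z₂z'₂. Hence
Lorentz-orthonormal rows give Euclidean-orthonormal rows of R. -/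
theorem inner_rotationRow {q z z' : E3 × ℝ} (hq : minkowski q q = -1) (hq0 : 0 < q.2)
    (hz : minkowski z q = 0) (hz' : minkowski z' q = 0) :
    ⟪rotationRow q z, rotationRow q z'⟫ = minkowski z z' := by
  have hb : q.2 + 1 ≠ 0 := by linarith
  have h1 := inner_self_of_minkowski hq
  have h2 : ⟪z.1, q.1⟫ = z.2 * q.2 := sub_eq_zero.1 hz
  have h3 : ⟪q.1, z'.1⟫ = z'.2 * q.2 := by rw [real_inner_comm]; exact sub_eq_zero.1 hz'
  simp only [rotationRow, minkowski, inner_sub_left, inner_sub_right, real_inner_smul_left,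
    real_inner_smul_right, h1, h2, h3]
  field_simp
  ring

theorem pairing_eq_rotationRow {q z : E3 × ℝ} (hq : minkowski q q = -1) (hq0 : 0 < q.2)
    (hz : minkowski z q = 0) (p : E3 × ℝ) :
    pairing z p = ⟪rotationRow q z, (boost q.1 p).1⟫ := by
  have hb : q.2 + 1 ≠ 0 := by linarith
  have h1 := inner_self_of_minkowski hq
  have h2 : ⟪z.1, q.1⟫ = z.2 * q.2 := sub_eq_zero.1 hz
  simp only [rotationRow, pairing, boost, inner_sub_left, inner_add_right, real_inner_smul_left,
    real_inner_smul_right, h1, h2, ← snd_eq_boostFactor hq hq0]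
  field_simp
  ring

/-- A smooth curve of Lorentz transformations, given by its parameters `w`, `R` and by the rows
`z i`, `q` of its matrices, which moves along the infinitesimal transformations `a`. -/
structure IsLorentzCurve (a : ℝ → E3 × E3) (w : ℝ → E3) (R : ℝ → Matrix (Fin 3) (Fin 3) ℝ)
    (z : Fin 3 → ℝ → E3 × ℝ) (q : ℝ → E3 × ℝ) : Prop where
  smooth_boost : ContDiffOn ℝ ∞ w (Ioi 0)
  smooth_rotation : ∀ i j, ContDiffOn ℝ ∞ (fun r => R r i j) (Ioi 0)
  mem_rotation : ∀ r, 0 < r → R r ∈ Matrix.specialOrthogonalGroup (Fin 3) ℝ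
  smooth_row : ∀ i, ContDiffOn ℝ ∞ (z i) (Ioi 0)
  smooth_time : ContDiffOn ℝ ∞ q (Ioi 0)
  deriv_row : ∀ i r, 0 < r → HasDerivAt (z i) (lorentzGenerator (a r) (z i r)) r
  deriv_time : ∀ r, 0 < r → HasDerivAt q (lorentzGenerator (a r) (q r)) r
  fst_lorentz : ∀ r, 0 < r → ∀ p i, (lorentz (w r) (R r) p).1 i = pairing (z i r) p
  snd_lorentz : ∀ r, 0 < r → ∀ p, (lorentz (w r) (R r) p).2 = pairing (q r) p

/-- Every initial Lorentz transformation extends to a curve with prescribed infinitesimal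
transformations. -/
theorem exists_isLorentzCurve {a : ℝ → E3 × E3} (ha : ContDiffOn ℝ ∞ a (Ioi 0))
    {r₀ : ℝ} (hr₀ : 0 < r₀) (w₀ : E3) {R₀ : Matrix (Fin 3) (Fin 3) ℝ}
    (hR₀ : R₀ ∈ Matrix.specialOrthogonalGroup (Fin 3) ℝ) :
    ∃ w R z q, IsLorentzCurve a w R z q ∧ w r₀ = w₀ ∧ R r₀ = R₀ := by
  let ρ : Fin 3 → E3 := fun i => WithLp.toLp 2 (R₀ i)
  -- The rows of the initial matrix R₀ (W, w₀); the remaining row is (w₀, b).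
  let k : Fin 3 → E3 × ℝ := fun i =>
    (ρ i + (⟪ρ i, w₀⟫ / (boostFactor w₀ + 1)) • w₀, ⟪ρ i, w₀⟫)
  have hb : boostFactor w₀ + 1 ≠ 0 := by linarith [one_le_boostFactor w₀]
  have hw₀ := inner_self_eq_boostFactor w₀
  have hρ : ∀ i j, ⟪ρ i, ρ j⟫ = (1 : Matrix (Fin 3) (Fin 3) ℝ) i j := fun i j => by
    rw [← (Matrix.mem_orthogonalGroup_iff _ _).1 (Matrix.mem_specialOrthogonalGroup_iff.1 hR₀).1,
      inner_E3, Matrix.mul_apply, Fin.sum_univ_three]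
    rfl
  choose z hz0 hzs hz using fun i => exists_lorentzGenerator_solution ha hr₀ (k i)
  obtain ⟨q, hq0, hqs, hq⟩ := exists_lorentzGenerator_solution ha hr₀ (w₀, boostFactor w₀)
  have hqq : ∀ r, 0 < r → minkowski (q r) (q r) = -1 := fun r hr => by
    rw [minkowski_const_of_lorentzGenerator hq hq hr hr₀, hq0]
    simp only [minkowski, hw₀]; ring
  have hzq : ∀ i r, 0 < r → minkowski (z i r) (q r) = 0 := fun i r hr => by
    rw [minkowski_const_of_lorentzGenerator (hz i) hq hr hr₀, hq0, hz0]
    simp only [k, minkowski, inner_add_left, real_inner_smul_left, hw₀]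
    field_simp
    ring
  have hzz : ∀ i j r, 0 < r →
      minkowski (z i r) (z j r) = (1 : Matrix (Fin 3) (Fin 3) ℝ) i j := fun i j r hr => by
    rw [minkowski_const_of_lorentzGenerator (hz i) (hz j) hr hr₀, hz0, hz0, ← hρ]
    simp only [k, minkowski, inner_add_left, inner_add_right, real_inner_smul_left,
      real_inner_smul_right, hw₀, real_inner_comm (ρ j) w₀]
    field_simp
    ring
  have hq2s : ContDiffOn ℝ ∞ (fun r => (q r).2) (Ioi 0) := contDiff_snd.comp_contDiffOn hqs
  have hq1s : ContDiffOn ℝ ∞ (fun r => (q r).1) (Ioi 0) := contDiff_fst.comp_contDiffOn hqs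
  have hqpos : ∀ r, 0 < r → 0 < (q r).2 := fun r hr => by
    refine pos_of_continuousOn_ne_zero hq2s.continuousOn (fun t ht h => ?_) hr₀ ?_ hr
    -- A zero time component would give the spatial part squared norm -1.
    · have := inner_self_of_minkowski (hqq t ht)
      rw [h] at this
      linarith [real_inner_self_nonneg (x := (q t).1)]
    · rw [hq0]; linarith [one_le_boostFactor w₀]
  let R : ℝ → Matrix (Fin 3) (Fin 3) ℝ := fun r => Matrix.of fun i => rotationRow (q r) (z i r)
  have hrow : ∀ i, ContDiffOn ℝ ∞ (fun r => rotationRow (q r) (z i r)) (Ioi 0) := fun i =>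
    (contDiff_fst.comp_contDiffOn (hzs i)).sub
      (((contDiff_snd.comp_contDiffOn (hzs i)).div (hq2s.add contDiffOn_const)
        fun r hr => by linarith [hqpos r hr]).smul hq1s)
  have hRs : ∀ i j, ContDiffOn ℝ ∞ (fun r => R r i j) (Ioi 0) := fun i j =>
    contDiffOn_euclidean.1 (hrow i) j
  have hRmul : ∀ r, 0 < r → R r * (R r).transpose = 1 := fun r hr => by
    ext i j
    rw [Matrix.mul_apply, Fin.sum_univ_three, ← hzz i j r hr,
      ← inner_rotationRow (hqq r hr) (hqpos r hr) (hzq i r hr) (hzq j r hr), inner_E3]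
    rfl
  have hR0 : R r₀ = R₀ := by
    ext i j
    have : rotationRow (q r₀) (z i r₀) = ρ i := by
      rw [hq0, hz0]; simp only [rotationRow, k]; module
    exact congrArg (fun x : E3 => x j) this
  have hdet : ∀ r, 0 < r → (R r).det = 1 := fun r hr => by
    have hsq : ∀ t, 0 < t → (R t).det * (R t).det = 1 := fun t ht => by
      have := congrArg Matrix.det (hRmul t ht)
      rwa [Matrix.det_mul, Matrix.det_transpose, Matrix.det_one] at this
    have hcont : ContinuousOn (fun t => (R t).det) (Ioi 0) := by
      simp only [Matrix.det_fin_three]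
      have := fun i j => (hRs i j).continuousOn
      fun_prop
    have hpos : 0 < (R r).det := by
      refine pos_of_continuousOn_ne_zero hcont (fun t ht h => ?_) hr₀ ?_ hr
      · have := hsq t ht
        rw [h] at this; norm_num at this
      · rw [hR0, (Matrix.mem_specialOrthogonalGroup_iff.1 hR₀).2]; exact one_pos
    nlinarith [hsq r hr]
  refine ⟨fun r => (q r).1, R, z, q, ⟨hq1s, hRs, fun r hr => ?_, hzs, hqs, hz, hq, fun r hr p i => ?_,
    fun r hr p => ?_⟩, congrArg Prod.fst hq0, hR0⟩
  · exact Matrix.mem_specialOrthogonalGroup_iff.2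
      ⟨(Matrix.mem_orthogonalGroup_iff _ _).2 (hRmul r hr), hdet r hr⟩
  · rw [pairing_eq_rotationRow (hqq r hr) (hqpos r hr) (hzq i r hr), inner_E3]
    exact matAct_apply _ _ _
  · rw [pairing, snd_eq_boostFactor (hqq r hr) (hqpos r hr)]
    rfl

end Frame

/-! ### The degenerate metric of the cone and polar coordinates -/

section Cone

theorem direction_mem_S2 {p : E3 × ℝ} (hp : p ∈ nullCone) : direction p ∈ S2 := by
  refine mem_S2_of_norm ?_
  rw [direction, norm_smul, norm_inv, norm_norm, inv_mul_cancel₀]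
  rw [← hp.1]; exact hp.2.ne'

theorem eq_smul_direction {p : E3 × ℝ} (hp : p ∈ nullCone) : p.1 = p.2 • direction p := by
  rw [direction, hp.1, smul_inv_smul₀]
  rw [← hp.1]; exact hp.2.ne'

/-- The derivative of a map into the null cone in terms of that of its direction. -/
theorem exists_hasFDerivAt_direction {X : Type*} [NormedAddCommGroup X] [NormedSpace ℝ X]
    {F : X → E3 × ℝ} {p : X} (hF : DifferentiableAt ℝ F p)
    (hcone : ∀ᶠ x in nhds p, F x ∈ nullCone) :
    ∃ D : X →L[ℝ] E3, HasFDerivAt (fun x => direction (F x)) D p ∧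
      (∀ u, ⟪direction (F p), D u⟫ = 0) ∧
      ∀ u, (fderiv ℝ F p u).1 = (fderiv ℝ F p u).2 • direction (F p) + (F p).2 • D u := by
  have h1 : HasFDerivAt (fun x => (F x).1) _ p := hF.hasFDerivAt.fst
  have h2 : HasFDerivAt (fun x => (F x).2) _ p := hF.hasFDerivAt.snd
  have hp := hcone.self_of_nhds
  have hd : DifferentiableAt ℝ (fun x => direction (F x)) p := by
    refine ((h2.differentiableAt.inv hp.2.ne').smul h1.differentiableAt).congr_of_eventuallyEq ?_
    filter_upwards [hcone] with x hx
    rw [direction, ← hx.1]; rfl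
  refine ⟨_, hd.hasFDerivAt, fun u => ?_, fun u => ?_⟩
  · have h3 := hd.hasFDerivAt.inner ℝ hd.hasFDerivAt
    have h4 : HasFDerivAt (fun x => ⟪direction (F x), direction (F x)⟫) (0 : X →L[ℝ] ℝ) p := by
      refine (hasFDerivAt_const (1 : ℝ) p).congr_of_eventuallyEq ?_
      filter_upwards [hcone] with x hx
      rw [real_inner_self_eq_norm_sq, norm_eq_one_of_mem_S2 (direction_mem_S2 hx), one_pow]
    have h5 := DFunLike.congr_fun (h3.unique h4) u
    simp only [ContinuousLinearMap.comp_apply, ContinuousLinearMap.prod_apply,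
      fderivInnerCLM_apply, zero_apply] at h5
    rw [real_inner_comm (direction (F p))] at h5
    linarith
  · have h3 := h2.smul hd.hasFDerivAt
    have h4 : HasFDerivAt (fun x => (F x).1) _ p := h3.congr_of_eventuallyEq (by
      filter_upwards [hcone] with x hx
      exact eq_smul_direction hx)
    have h5 := DFunLike.congr_fun (h1.unique h4) u
    simpa [add_comm] using h5

/-- The metric t²|dζ|² of the cone, evaluated on derivatives of the point t(ζ, 1): the part along
the null ray drops out. -/
theorem minkowski_eq_of_direction {x y ζ d e : E3} {a b ρ : ℝ} (hζ : ⟪ζ, ζ⟫ = 1)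
    (hd : ⟪ζ, d⟫ = 0) (he : ⟪ζ, e⟫ = 0) (hx : x = a • ζ + ρ • d) (hy : y = b • ζ + ρ • e) :
    minkowski (x, a) (y, b) = ρ ^ 2 * ⟪d, e⟫ := by
  have hd' : ⟪d, ζ⟫ = 0 := by rw [real_inner_comm, hd]
  simp only [minkowski, hx, hy, inner_add_left, inner_add_right, real_inner_smul_left,
    real_inner_smul_right, hζ, hd', he]
  ring

/-- Orientation of the direction map can be tested on position and derivatives in ℝ³, since radial
components do not affect the triple product. -/
theorem triple_eq_of_direction (ζ d e : E3) (a b ρ : ℝ) :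
    ⟪ρ • ζ, cross (a • ζ + ρ • d) (b • ζ + ρ • e)⟫ = ρ ^ 3 * ⟪ζ, cross d e⟫ := by
  simp only [inner_E3, cross_zero, cross_one, cross_two, PiLp.add_apply, PiLp.smul_apply,
    smul_eq_mul]
  ring

theorem ne_zero_of_mem_S2 {θ : E3} (hθ : θ ∈ S2) : θ ≠ 0 := by
  rintro rfl
  simpa using norm_eq_one_of_mem_S2 hθ

theorem normalize_mem_S2 {x : E3} (hx : x ≠ 0) : ‖x‖⁻¹ • x ∈ S2 := by
  refine mem_S2_of_norm ?_
  rw [norm_smul, norm_inv, norm_norm, inv_mul_cancel₀ (norm_ne_zero_iff.2 hx)]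

theorem angExt_of_mem_S2 {V : Type*} (h : E3 → V) {θ : E3} (hθ : θ ∈ S2) : angExt h θ = h θ := by
  rw [angExt, norm_eq_one_of_mem_S2 hθ, inv_one, one_smul]

theorem polarExt_of_mem_S2 (Φ : E3 × ℝ → E3 × ℝ) (r : ℝ) {θ : E3} (hθ : θ ∈ S2) :
    polarExt Φ (r, θ) = Φ (sphereIncl r θ) := angExt_of_mem_S2 _ hθ

theorem polarExt_mem_nullCone {Φ : E3 × ℝ → E3 × ℝ} (hΦ : MapsTo Φ nullCone nullCone) {r : ℝ}
    (hr : 0 < r) {x : E3} (hx : x ≠ 0) : polarExt Φ (r, x) ∈ nullCone :=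
  hΦ (sphereIncl_mem_nullCone hr (normalize_mem_S2 hx))

theorem isOpen_polarDomain : IsOpen (Ioi (0 : ℝ) ×ˢ ({0}ᶜ : Set E3)) :=
  isOpen_Ioi.prod isOpen_compl_singleton

theorem eventually_polarExt_mem_nullCone {Φ : E3 × ℝ → E3 × ℝ} (hΦ : MapsTo Φ nullCone nullCone)
    {r : ℝ} (hr : 0 < r) {θ : E3} (hθ : θ ∈ S2) :
    ∀ᶠ p in nhds (r, θ), polarExt Φ p ∈ nullCone := by
  filter_upwards [isOpen_polarDomain.mem_nhds ⟨hr, ne_zero_of_mem_S2 hθ⟩] with p hp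
  exact polarExt_mem_nullCone hΦ hp.1 hp.2

theorem differentiableAt_polarExt {Φ : E3 × ℝ → E3 × ℝ}
    (hΦ : ContDiffOn ℝ ∞ (polarExt Φ) (Ioi 0 ×ˢ {0}ᶜ)) {r : ℝ} (hr : 0 < r) {θ : E3}
    (hθ : θ ∈ S2) : DifferentiableAt ℝ (polarExt Φ) (r, θ) := by
  have hmem : (r, θ) ∈ Ioi (0 : ℝ) ×ˢ ({0}ᶜ : Set E3) := ⟨hr, ne_zero_of_mem_S2 hθ⟩
  exact (hΦ.contDiffAt (isOpen_polarDomain.mem_nhds hmem)).differentiableAt (by simp)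

theorem fderiv_angExt_sphereIncl {Φ : E3 × ℝ → E3 × ℝ}
    (hΦ : ContDiffOn ℝ ∞ (polarExt Φ) (Ioi 0 ×ˢ {0}ᶜ)) {r : ℝ} (hr : 0 < r) {θ : E3}
    (hθ : θ ∈ S2) (u : E3) :
    fderiv ℝ (angExt fun θ => Φ (sphereIncl r θ)) θ u = fderiv ℝ (polarExt Φ) (r, θ) (0, u) := by
  have h := (differentiableAt_polarExt hΦ hr hθ).hasFDerivAt.comp θ (hasFDerivAt_prodMk_right r θ)
  have h' : HasFDerivAt (angExt fun θ => Φ (sphereIncl r θ)) _ θ := h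
  rw [h'.fderiv]
  simp

theorem hasDerivAt_normalize {θ u : E3} (hθ : θ ∈ S2) (hu : ⟪θ, u⟫ = 0) :
    HasDerivAt (fun t : ℝ => ‖θ + t • u‖⁻¹ • (θ + t • u)) u 0 := by
  have h1 : HasDerivAt (fun t : ℝ => θ + t • u) u 0 := by
    simpa using ((hasDerivAt_id (0 : ℝ)).smul_const u).const_add θ
  have hn := norm_eq_one_of_mem_S2 hθ
  have h2 : HasDerivAt (fun t : ℝ => ‖θ + t • u‖) 0 0 := by
    have := (h1.norm_sq).sqrt (by simp [hn])
    simpa [hu, Real.sqrt_sq] using this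
  have h3 := (h2.inv (by simp [hn])).smul h1
  exact h3.congr_deriv (by simp [hn])

end Cone

/-! ### Existence: the map defined by a Lorentz curve -/

section CurveMap

variable {a : ℝ → E3 × E3} {w : ℝ → E3} {R : ℝ → Matrix (Fin 3) (Fin 3) ℝ}
  {z : Fin 3 → ℝ → E3 × ℝ} {q : ℝ → E3 × ℝ}

/-- The map of the null cone that acts on the sphere of radius `r` by the Lorentz transformation
with parameters `w r` and `R r`. -/
noncomputable def lorentzCurveMap (w : ℝ → E3) (R : ℝ → Matrix (Fin 3) (Fin 3) ℝ) (p : E3 × ℝ) :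
    E3 × ℝ := lorentz (w p.2) (R p.2) p

/-- The shear vector of the map given by a curve of Lorentz transformations. -/
noncomputable def generatorShear (a : E3 × E3) (r : ℝ) (θ : E3) : E3 :=
  r • (angProj θ a.2 + cross θ a.1)

theorem inner_generatorShear (a : E3 × E3) (r : ℝ) {θ : E3} (hθ : θ ∈ S2) :
    ⟪θ, generatorShear a r θ⟫ = 0 := by
  rw [generatorShear, real_inner_smul_right, inner_add_right, inner_cross_self_left, angProj,
    inner_sub_right, real_inner_smul_right, real_inner_self_eq_norm_sq, norm_eq_one_of_mem_S2 hθ]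
  ring

theorem IsLorentzCurve.mapsTo (h : IsLorentzCurve a w R z q) :
    MapsTo (lorentzCurveMap w R) nullCone nullCone := fun _ hp =>
  lorentz_mem_nullCone _ (h.mem_rotation _ hp.2) hp

theorem IsLorentzCurve.contDiffOn_polarExt (h : IsLorentzCurve a w R z q) :
    ContDiffOn ℝ ∞ (polarExt (lorentzCurveMap w R)) (Ioi 0 ×ˢ {0}ᶜ) := by
  have hfst : ContDiffOn ℝ ∞ (fun p : ℝ × E3 => p.1) (Ioi 0 ×ˢ {0}ᶜ) := contDiff_fst.contDiffOn
  have hsnd : ContDiffOn ℝ ∞ (fun p : ℝ × E3 => p.2) (Ioi 0 ×ˢ {0}ᶜ) := contDiff_snd.contDiffOn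
  have hx : ContDiffOn ℝ ∞ (fun p : ℝ × E3 => (p.1 • (‖p.2‖⁻¹ • p.2), p.1))
      (Ioi 0 ×ˢ {0}ᶜ) :=
    (hfst.smul (((hsnd.norm ℝ fun _ hp => hp.2).inv
      fun p hp => norm_ne_zero_iff.2 hp.2).smul hsnd)).prodMk hfst
  have hpair : ∀ y : ℝ → E3 × ℝ, ContDiffOn ℝ ∞ y (Ioi 0) →
      ContDiffOn ℝ ∞ (fun p : ℝ × E3 => pairing (y p.1) (p.1 • (‖p.2‖⁻¹ • p.2), p.1))
        (Ioi 0 ×ˢ {0}ᶜ) := fun y hy => by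
    have hy' : ContDiffOn ℝ ∞ (fun p : ℝ × E3 => y p.1) (Ioi 0 ×ˢ {0}ᶜ) :=
      hy.comp hfst fun p hp => hp.1
    exact (hy'.fst.inner ℝ hx.fst).add (hy'.snd.mul hx.snd)
  have h1 : ContDiffOn ℝ ∞ (fun p => (polarExt (lorentzCurveMap w R) p).1)
      (Ioi 0 ×ˢ {0}ᶜ) :=
    contDiffOn_euclidean.2 fun i => (hpair _ (h.smooth_row i)).congr fun p hp =>
      h.fst_lorentz _ hp.1 _ i
  have h2 : ContDiffOn ℝ ∞ (fun p => (polarExt (lorentzCurveMap w R) p).2)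
      (Ioi 0 ×ˢ {0}ᶜ) :=
    (hpair _ h.smooth_time).congr fun p hp => h.snd_lorentz _ hp.1 _
  exact h1.prodMk h2

/-- Differentiate each component, the pairing of a row with (rθ, r), along a curve through (r, θ).
The motion of the row is transposed onto the point and then split into its part along (θ, 1) and a
tangential part, the shear. -/
theorem IsLorentzCurve.fderiv_polarExt (h : IsLorentzCurve a w R z q) {r : ℝ} (hr : 0 < r)
    {θ : E3} (hθ : θ ∈ S2) (k : ℝ) {u : E3} (hu : ⟪θ, u⟫ = 0) :
    fderiv ℝ (polarExt (lorentzCurveMap w R)) (r, θ) (k, u) =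
      lorentz (w r) (R r) (r • u + k • generatorShear (a r) r θ +
        (k * (1 + r * ⟪(a r).2, θ⟫)) • θ, k * (1 + r * ⟪(a r).2, θ⟫)) := by
  have hc : HasDerivAt (fun t : ℝ => (r + t * k, θ + t • u)) (k, u) 0 := by
    refine HasDerivAt.prodMk ?_ ?_
    · simpa using ((hasDerivAt_id (0 : ℝ)).mul_const k).const_add r
    · simpa using ((hasDerivAt_id (0 : ℝ)).smul_const u).const_add θ
  have hs : HasDerivAt (fun t : ℝ => r + t * k) k 0 := by
    simpa using ((hasDerivAt_id (0 : ℝ)).mul_const k).const_add r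
  have hd : HasFDerivAt (polarExt (lorentzCurveMap w R))
      (fderiv ℝ (polarExt (lorentzCurveMap w R)) (r, θ)) (r + 0 * k, θ + (0 : ℝ) • u) := by
    simpa using (differentiableAt_polarExt h.contDiffOn_polarExt hr hθ).hasFDerivAt
  have hF := hd.comp_hasDerivAt (0 : ℝ) hc
  have hpos : ∀ᶠ t : ℝ in nhds 0, 0 < r + t * k :=
    hs.continuousAt.eventually (lt_mem_nhds (by simpa using hr))
  have hn := norm_eq_one_of_mem_S2 hθ
  have hp : HasDerivAt (fun t : ℝ => ((r + t * k) • (‖θ + t • u‖⁻¹ • (θ + t • u)), r + t * k))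
      (r • u + k • θ, k) 0 := by
    refine HasDerivAt.prodMk ?_ hs
    exact (hs.smul (hasDerivAt_normalize hθ hu)).congr_deriv (by simp [hn])
  have hrow : ∀ y : ℝ → E3 × ℝ, HasDerivAt y (lorentzGenerator (a r) (y r)) r →
      HasDerivAt (fun t : ℝ => pairing (y (r + t * k))
        ((r + t * k) • (‖θ + t • u‖⁻¹ • (θ + t • u)), r + t * k))
        (pairing (y r) (r • u + k • generatorShear (a r) r θ +
        (k * (1 + r * ⟪(a r).2, θ⟫)) • θ, k * (1 + r * ⟪(a r).2, θ⟫))) 0 := fun y hy => by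
    have hy' : HasDerivAt y (lorentzGenerator (a r) (y r)) (r + 0 * k) := by simpa using hy
    refine (hasDerivAt_pairing (hy'.scomp (0 : ℝ) hs) hp).congr_deriv ?_
    simp only [Function.comp, zero_mul, add_zero, zero_smul, hn, inv_one, one_smul]
    simp only [pairing, lorentzGenerator_apply, generatorShear, angProj, inner_E3, PiLp.add_apply,
      PiLp.smul_apply, PiLp.sub_apply, cross_zero, cross_one, cross_two, smul_eq_mul, Prod.smul_fst,
      Prod.smul_snd]
    ring
  refine Prod.ext ?_ ?_
  · ext i
    rw [h.fst_lorentz r hr]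
    have h1 := (EuclideanSpace.proj (𝕜 := ℝ) i).hasFDerivAt.comp_hasDerivAt (0 : ℝ)
      (hasFDerivAt_fst.comp_hasDerivAt (0 : ℝ) hF)
    refine h1.unique ((hrow _ (h.deriv_row i r hr)).congr_of_eventuallyEq ?_)
    filter_upwards [hpos] with t ht
    exact h.fst_lorentz _ ht _ i
  · rw [h.snd_lorentz r hr]
    refine (hasFDerivAt_snd.comp_hasDerivAt (0 : ℝ) hF).unique ((hrow _ (h.deriv_time r hr)).congr_of_eventuallyEq ?_)
    filter_upwards [hpos] with t ht
    exact h.snd_lorentz _ ht _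

theorem IsLorentzCurve.hasShear (h : IsLorentzCurve a w R z q) {β : ℝ → E3 → E3}
    (hβ : ∀ r, 0 < r → ∀ θ, β r θ = generatorShear (a r) r θ) :
    HasShear (lorentzCurveMap w R) β := by
  intro r hr θ hθ
  have hs := inner_generatorShear (a r) r hθ
  rw [hβ r hr]
  refine ⟨hs, fun k k' u u' hu hu' => ?_⟩
  rw [h.fderiv_polarExt hr hθ k hu, h.fderiv_polarExt hr hθ k' hu',
    minkowski_lorentz _ (h.mem_rotation r hr)]
  have hθ1 : ⟪θ, θ⟫ = 1 := by
    rw [real_inner_self_eq_norm_sq, norm_eq_one_of_mem_S2 hθ, one_pow]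
  have e1 : ⟪θ, r • u + k • generatorShear (a r) r θ⟫ = 0 := by
    rw [inner_add_right, real_inner_smul_right, real_inner_smul_right, hu, hs]; ring
  have e2 : ⟪θ, r • u' + k' • generatorShear (a r) r θ⟫ = 0 := by
    rw [inner_add_right, real_inner_smul_right, real_inner_smul_right, hu', hs]; ring
  -- The vectors are tangent to the cone at (θ, 1), so their null components do not contribute.
  rw [minkowski_eq_of_direction (ρ := 1) hθ1 e1 e2 (by module) (by module)]
  ring

theorem IsLorentzCurve.isQuasiSphere (h : IsLorentzCurve a w R z q) {r : ℝ} (hr : 0 < r) :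
    IsQuasiSphere r fun θ => lorentzCurveMap w R (sphereIncl r θ) := by
  have hR := h.mem_rotation r hr
  have hsmooth := h.contDiffOn_polarExt
  have hiso : ∀ θ ∈ S2, ∀ u v : E3, ⟪θ, u⟫ = 0 → ⟪θ, v⟫ = 0 →
      minkowski (fderiv ℝ (angExt fun θ => lorentzCurveMap w R (sphereIncl r θ)) θ u)
        (fderiv ℝ (angExt fun θ => lorentzCurveMap w R (sphereIncl r θ)) θ v) =
          r ^ 2 * ⟪u, v⟫ := by
    intro θ hθ u v hu hv
    rw [fderiv_angExt_sphereIncl hsmooth hr hθ, fderiv_angExt_sphereIncl hsmooth hr hθ,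
      -- The isometry condition is the shear identity without radial components.
      ((h.hasShear fun _ _ _ => rfl) r hr θ hθ).2 0 0 u v hu hv]
    simp only [zero_smul, add_zero, real_inner_smul_left, real_inner_smul_right]
    ring
  have hang : ContDiffOn ℝ ∞ (angExt fun θ => lorentzCurveMap w R (sphereIncl r θ)) {0}ᶜ :=
    hsmooth.comp (f := fun x : E3 => (r, x)) (contDiff_const.prodMk contDiff_id).contDiffOn
      fun x hx => ⟨hr, hx⟩
  refine ⟨fun θ hθ => h.mapsTo (sphereIncl_mem_nullCone hr hθ), hang, ?_, ?_, ?_, hiso⟩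
  · intro θ _ η _ e
    have e' := congrArg Prod.fst (lorentz_injective (w r) hR e)
    exact smul_right_injective _ hr.ne' e'
  · intro θ hθ v hv h0
    have h1 := hiso θ hθ v v hv hv
    rw [h0, real_inner_self_eq_norm_sq] at h1
    have h2 : r ^ 2 * ‖v‖ ^ 2 = 0 := by rw [← h1]; simp [minkowski]
    simpa [hr.ne'] using h2
  · intro θ hθ u v hu hv huv
    have hcone : ∀ᶠ x in nhds θ,
        angExt (fun θ => lorentzCurveMap w R (sphereIncl r θ)) x ∈ nullCone := by
      filter_upwards [isOpen_compl_singleton.mem_nhds (ne_zero_of_mem_S2 hθ)] with x hx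
      exact polarExt_mem_nullCone h.mapsTo hr hx
    have hdiff : DifferentiableAt ℝ (angExt fun θ => lorentzCurveMap w R (sphereIncl r θ)) θ :=
      (hang.contDiffAt (isOpen_compl_singleton.mem_nhds (ne_zero_of_mem_S2 hθ))).differentiableAt
        (by simp)
    obtain ⟨D, hD, -, hDu⟩ := exists_hasFDerivAt_direction hdiff hcone
    have hD' : HasFDerivAt
        (angExt fun η => direction (lorentzCurveMap w R (sphereIncl r η))) D θ := hD
    rw [hD'.fderiv]
    have hval : angExt (fun θ => lorentzCurveMap w R (sphereIncl r θ)) θ =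
        r • lorentz (w r) (R r) (θ, 1) := by
      rw [angExt_of_mem_S2 _ hθ, ← map_smul]
      simp [lorentzCurveMap, sphereIncl]
    have hder : ∀ u, ⟪θ, u⟫ = 0 →
        fderiv ℝ (angExt fun θ => lorentzCurveMap w R (sphereIncl r θ)) θ u =
          r • lorentz (w r) (R r) (u, 0) := by
      intro u hu
      rw [fderiv_angExt_sphereIncl hsmooth hr hθ, h.fderiv_polarExt hr hθ 0 hu, ← map_smul]
      simp
    have hp := hcone.self_of_nhds
    have h1 := triple_eq_of_direction
      (direction (angExt (fun θ => lorentzCurveMap w R (sphereIncl r θ)) θ)) (D u) (D v)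
      (fderiv ℝ (angExt fun θ => lorentzCurveMap w R (sphereIncl r θ)) θ u).2
      (fderiv ℝ (angExt fun θ => lorentzCurveMap w R (sphereIncl r θ)) θ v).2
      (angExt (fun θ => lorentzCurveMap w R (sphereIncl r θ)) θ).2
    rw [← eq_smul_direction hp, ← hDu, ← hDu, hder u hu, hder v hv, hval, Prod.smul_fst,
      Prod.smul_fst, Prod.smul_fst, cross_smul_left, cross_smul_right, real_inner_smul_left,
      real_inner_smul_right, real_inner_smul_right] at h1
    have h2 := triple_lorentz_pos (w r) hR hθ hu hv huv
    have h3 : 0 < (r • lorentz (w r) (R r) (θ, 1)).2 := by rw [← hval]; exact hp.2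
    have h4 : 0 < (r • lorentz (w r) (R r) (θ, 1)).2 ^ 3 *
        ⟪direction (r • lorentz (w r) (R r) (θ, 1)), cross (D u) (D v)⟫ := by
      rw [← h1]; positivity
    have h5 := (mul_pos_iff_of_pos_left (by positivity)).1 h4
    rwa [← hval, angExt_of_mem_S2 _ hθ] at h5

theorem IsLorentzCurve.isQuasiSphericalMap (h : IsLorentzCurve a w R z q) :
    IsQuasiSphericalMap (lorentzCurveMap w R) :=
  ⟨h.mapsTo, h.contDiffOn_polarExt, fun _ hr => h.isQuasiSphere hr⟩

end CurveMap

/-! ### Uniqueness: transport along characteristics -/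

section Uniqueness

/-- The shear vector field has characteristic curves through all points, defined for all radii. -/
theorem exists_characteristic {a : ℝ → E3 × E3} (ha : ContDiffOn ℝ ∞ a (Ioi 0)) {r₁ : ℝ}
    (hr₁ : 0 < r₁) {θ₁ : E3} (hθ₁ : θ₁ ∈ S2) :
    ∃ c : ℝ → E3, c r₁ = θ₁ ∧ (∀ r, 0 < r → c r ∈ S2) ∧
      ∀ r, 0 < r → HasDerivAt c (-(r⁻¹ • generatorShear (a r) r (c r))) r := by
  -- The characteristic equation is the projectivization of the linear row equation: for a null
  -- solution y, the curve -y₁ / y₂ satisfies it. The minus sign reflects passing from rows to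
  -- vectors by the Minkowski form, and gives the initial value (-θ₁, 1).
  obtain ⟨y, hy0, -, hy⟩ := exists_lorentzGenerator_solution ha hr₁ (-θ₁, 1)
  -- The product of y with this timelike solution stays equal to -1, so y never vanishes and, being
  -- null, has y₂ ≠ 0.
  obtain ⟨q, hq0, -, hq⟩ := exists_lorentzGenerator_solution ha hr₁ ((0 : E3), (1 : ℝ))
  have hyy : ∀ r, 0 < r → ⟪(y r).1, (y r).1⟫ = (y r).2 ^ 2 := fun r hr => by
    have := minkowski_const_of_lorentzGenerator hy hy hr hr₁
    rw [hy0] at this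
    simp only [minkowski, inner_neg_neg, real_inner_self_eq_norm_sq θ₁,
      norm_eq_one_of_mem_S2 hθ₁] at this
    linarith
  have hne : ∀ r, 0 < r → (y r).2 ≠ 0 := fun r hr h => by
    have h1 := hyy r hr
    rw [h, zero_pow two_ne_zero, inner_self_eq_zero] at h1
    have h2 := minkowski_const_of_lorentzGenerator hy hq hr hr₁
    rw [hy0, hq0] at h2
    simp [minkowski, h, h1] at h2
  have hd1 : ∀ r, 0 < r → HasDerivAt (fun t => (y t).1)
      (lorentzGenerator (a r) (y r)).1 r := fun r hr =>
    (hasFDerivAt_fst (𝕜 := ℝ) (p := y r)).comp_hasDerivAt r (hy r hr)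
  have hd2 : ∀ r, 0 < r → HasDerivAt (fun t => (y t).2)
      (lorentzGenerator (a r) (y r)).2 r := fun r hr =>
    (hasFDerivAt_snd (𝕜 := ℝ) (p := y r)).comp_hasDerivAt r (hy r hr)
  have hpos : ∀ r, 0 < r → 0 < (y r).2 := fun r hr =>
    pos_of_continuousOn_ne_zero (fun t ht => (hd2 t ht).continuousAt.continuousWithinAt) hne hr₁
      (by rw [hy0]; exact one_pos) hr
  refine ⟨fun r => -((y r).2⁻¹ • (y r).1), ?_, fun r hr => mem_S2_of_norm ?_, fun r hr => ?_⟩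
  · simp [hy0]
  · have h1 := hyy r hr
    rw [real_inner_self_eq_norm_sq, sq_eq_sq₀ (norm_nonneg _) (hpos r hr).le] at h1
    rw [norm_neg, norm_smul, norm_inv, h1, Real.norm_of_nonneg (hpos r hr).le,
      inv_mul_cancel₀ (hne r hr)]
  · refine (((hd2 r hr).inv (hne r hr)).smul (hd1 r hr)).neg.congr_deriv ?_
    have hb := hne r hr
    simp only [generatorShear, inv_smul_smul₀ hr.ne']
    refine ext_E3 ?_ ?_ ?_ <;>
    · simp only [lorentzGenerator_apply, angProj, inner_E3, PiLp.add_apply, PiLp.smul_apply,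
        PiLp.sub_apply, PiLp.neg_apply, cross_zero, cross_one, cross_two, smul_eq_mul, Pi.inv_apply]
      field_simp
      ring

/-- The directions of the images of a map are constant along the characteristics of its shear. -/
theorem HasShear.direction_const {Ψ : E3 × ℝ → E3 × ℝ} {β : ℝ → E3 → E3}
    (hΨ : IsQuasiSphericalMap Ψ) (hs : HasShear Ψ β) {c : ℝ → E3} (hc : ∀ r, 0 < r → c r ∈ S2)
    (hd : ∀ r, 0 < r → HasDerivAt c (-(r⁻¹ • β r (c r))) r) {r s : ℝ} (hr : 0 < r) (h0 : 0 < s) :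
    direction (Ψ (sphereIncl r (c r))) = direction (Ψ (sphereIncl s (c s))) := by
  suffices h : ∀ t, 0 < t → HasDerivAt (fun t => direction (polarExt Ψ (t, c t))) 0 t by
    have := eq_of_hasDerivAt_zero h hr h0
    rwa [polarExt_of_mem_S2 _ _ (hc r hr), polarExt_of_mem_S2 _ _ (hc s h0)] at this
  intro t ht
  have hcone := eventually_polarExt_mem_nullCone hΨ.mapsTo ht (hc t ht)
  obtain ⟨D, hD, hD1, hD2⟩ := exists_hasFDerivAt_direction
    (differentiableAt_polarExt hΨ.smooth ht (hc t ht)) hcone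
  refine (hD.comp_hasDerivAt t ((hasDerivAt_id t).prodMk (hd t ht))).congr_deriv ?_
  obtain ⟨hβ, hm⟩ := hs t ht (c t) (hc t ht)
  have hu : ⟪c t, -(t⁻¹ • β t (c t))⟫ = 0 := by
    rw [inner_neg_right, real_inner_smul_right, hβ, mul_zero, neg_zero]
  have h1 := hm 1 1 _ _ hu hu
  -- The velocity (1, c') lies in the kernel of r dθ + β dr, so t²|dζ|² vanishes on it.
  have hz : t • -(t⁻¹ • β t (c t)) + (1 : ℝ) • β t (c t) = 0 := by
    rw [smul_neg, smul_inv_smul₀ ht.ne', one_smul, neg_add_cancel]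
  have hp := hcone.self_of_nhds
  have hn : ⟪direction (polarExt Ψ (t, c t)), direction (polarExt Ψ (t, c t))⟫ = 1 := by
    rw [real_inner_self_eq_norm_sq, norm_eq_one_of_mem_S2 (direction_mem_S2 hp), one_pow]
  have h2 := minkowski_eq_of_direction hn (hD1 _) (hD1 _) (hD2 (1, -(t⁻¹ • β t (c t))))
    (hD2 (1, -(t⁻¹ • β t (c t))))
  rw [Prod.mk.eta, h1, hz, inner_zero_left] at h2
  exact inner_self_eq_zero.1 ((mul_eq_zero.1 h2.symm).resolve_left (pow_ne_zero 2 hp.2.ne'))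

theorem exists_ne_zero_orthogonal (θ : E3) : ∃ u : E3, u ≠ 0 ∧ ⟪θ, u⟫ = 0 := by
  by_cases h : θ 0 = 0
  · exact ⟨EuclideanSpace.single 0 1, by simp, by simp [EuclideanSpace.inner_single_right, h]⟩
  · refine ⟨!₂[-θ 1, θ 0, 0], fun e => h ?_, ?_⟩
    · simpa using congrArg (fun x : E3 => x 1) e
    · rw [inner_E3]
      simp
      ring

/-- A quasi-spherical map is determined by its shear and its directions on all spheres. -/
theorem eqOn_of_direction_eq {Ψ Φ : E3 × ℝ → E3 × ℝ} {β : ℝ → E3 → E3}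
    (hΨ : IsQuasiSphericalMap Ψ) (hΨs : HasShear Ψ β) (hΦ : IsQuasiSphericalMap Φ)
    (hΦs : HasShear Φ β)
    (h : ∀ r, 0 < r → ∀ θ ∈ S2, direction (Ψ (sphereIncl r θ)) = direction (Φ (sphereIncl r θ))) :
    EqOn Ψ Φ nullCone := by
  intro p hp
  obtain ⟨hr, hθ, e⟩ := exists_sphereIncl_of_mem_nullCone hp
  rw [← e]
  generalize p.2 = r at *
  generalize r⁻¹ • p.1 = θ at *
  have hΨc := eventually_polarExt_mem_nullCone hΨ.mapsTo hr hθ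
  have hΦc := eventually_polarExt_mem_nullCone hΦ.mapsTo hr hθ
  obtain ⟨D, hD, hD1, hD2⟩ := exists_hasFDerivAt_direction
    (differentiableAt_polarExt hΨ.smooth hr hθ) hΨc
  obtain ⟨D', hD', hD1', hD2'⟩ := exists_hasFDerivAt_direction
    (differentiableAt_polarExt hΦ.smooth hr hθ) hΦc
  -- The directions agree on a whole neighbourhood, hence so do their derivatives.
  have hDD : D = D' := by
    refine hD.unique (hD'.congr_of_eventuallyEq ?_)
    filter_upwards [isOpen_polarDomain.mem_nhds
      (show (r, θ) ∈ Ioi (0 : ℝ) ×ˢ ({0}ᶜ : Set E3) from ⟨hr, ne_zero_of_mem_S2 hθ⟩)] with x hx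
    exact h x.1 hx.1 _ (normalize_mem_S2 hx.2)
  subst hDD
  -- One nonzero tangent vector suffices to compare t² for both maps: dζ(u) is common and nonzero
  -- because t²|dζ(u)|² = r²|u|².
  obtain ⟨u, hu0, hu⟩ := exists_ne_zero_orthogonal θ
  have hn : ∀ q ∈ nullCone, ⟪direction q, direction q⟫ = 1 := fun q hq => by
    rw [real_inner_self_eq_norm_sq, norm_eq_one_of_mem_S2 (direction_mem_S2 hq), one_pow]
  have hp1 := hΨc.self_of_nhds
  have hp2 := hΦc.self_of_nhds
  have h1 := minkowski_eq_of_direction (hn _ hp1) (hD1 _) (hD1 _) (hD2 (0, u)) (hD2 (0, u))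
  have h2 := minkowski_eq_of_direction (hn _ hp2) (hD1' _) (hD1' _) (hD2' (0, u)) (hD2' (0, u))
  rw [Prod.mk.eta, (hΨs r hr θ hθ).2 0 0 u u hu hu] at h1
  rw [Prod.mk.eta, (hΦs r hr θ hθ).2 0 0 u u hu hu, h1] at h2
  rw [polarExt_of_mem_S2 _ _ hθ] at h1 h2 hp1
  rw [polarExt_of_mem_S2 _ _ hθ] at h2 hp2
  have hDu : ⟪D (0, u), D (0, u)⟫ ≠ 0 := fun h0 => by
    rw [h0, mul_zero, zero_smul, add_zero, inner_self_eq_zero] at h1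
    exact smul_ne_zero hr.ne' hu0 h1
  have h3 : (Ψ (sphereIncl r θ)).2 = (Φ (sphereIncl r θ)).2 :=
    (sq_eq_sq₀ hp1.2.le hp2.2.le).1 (mul_right_cancel₀ hDu h2)
  refine Prod.ext ?_ h3
  rw [eq_smul_direction hp1, eq_smul_direction hp2, h3, h r hr θ hθ]

/-- A quasi-spherical map is determined by its shear and its values on one sphere. -/
theorem eqOn_of_hasShear {a : ℝ → E3 × E3} (ha : ContDiffOn ℝ ∞ a (Ioi 0)) {β : ℝ → E3 → E3}
    (hβ : ∀ r, 0 < r → ∀ θ, β r θ = generatorShear (a r) r θ) {Ψ Φ : E3 × ℝ → E3 × ℝ}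
    (hΨ : IsQuasiSphericalMap Ψ) (hΨs : HasShear Ψ β) (hΦ : IsQuasiSphericalMap Φ)
    (hΦs : HasShear Φ β) {r₀ : ℝ} (hr₀ : 0 < r₀)
    (h : ∀ θ ∈ S2, Ψ (sphereIncl r₀ θ) = Φ (sphereIncl r₀ θ)) : EqOn Ψ Φ nullCone := by
  refine eqOn_of_direction_eq hΨ hΨs hΦ hΦs fun r hr θ hθ => ?_
  obtain ⟨c, rfl, hc, hd⟩ := exists_characteristic ha hr hθ
  have hd' : ∀ r, 0 < r → HasDerivAt c (-(r⁻¹ • β r (c r))) r := fun r hr => by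
    rw [hβ r hr]; exact hd r hr
  rw [hΨs.direction_const hΨ hc hd' hr hr₀, hΦs.direction_const hΦ hc hd' hr hr₀, h _ (hc _ hr₀)]

end Uniqueness

/-! ### The theorem -/

theorem proposition3 (s₁ t₁ : ℝ → E3)
    (hs : ContDiffOn ℝ ∞ s₁ (Ioi 0)) (ht : ContDiffOn ℝ ∞ t₁ (Ioi 0))
    (r₀ : ℝ) (hr₀ : 0 < r₀) (w₀ : E3) (R₀ : Matrix (Fin 3) (Fin 3) ℝ)
    (hR₀ : R₀ ∈ Matrix.specialOrthogonalGroup (Fin 3) ℝ)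
    (β : ℝ → E3 → E3)
    -- `β` in the normalization of the statement, or with the extra factor `r`; both are covered
    (hβ : (∀ r θ, β r θ = angProj θ (t₁ r) + cross θ (s₁ r)) ∨
      (∀ r θ, β r θ = r • angProj θ (t₁ r) + r • cross θ (s₁ r))) :
    ∃ (Φ : E3 × ℝ → E3 × ℝ) (w : ℝ → E3) (R : ℝ → Matrix (Fin 3) (Fin 3) ℝ),
      IsQuasiSphericalMap Φ ∧
      ContDiffOn ℝ ∞ w (Ioi 0) ∧
      (∀ i j, ContDiffOn ℝ ∞ (fun r => R r i j) (Ioi 0)) ∧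
      (∀ r, 0 < r → HasParametersAt Φ r (w r) (R r)) ∧
      w r₀ = w₀ ∧ R r₀ = R₀ ∧
      HasShear Φ β ∧
      -- the parameters of `Φ` are uniquely determined
      (∀ r, 0 < r → ∀ w' R', HasParametersAt Φ r w' R' → w' = w r ∧ R' = R r) ∧
      -- uniqueness among all smooth quasi-spherical maps with these initial parameters
      (∀ Ψ : E3 × ℝ → E3 × ℝ, IsQuasiSphericalMap Ψ → HasParametersAt Ψ r₀ w₀ R₀ →
        HasShear Ψ β → EqOn Ψ Φ nullCone) := by
  -- `generatorShear` carries a factor r, so the first normalization needs the generator divided by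
  -- r, while the second uses (s₁, t₁) itself.
  obtain ⟨a, ha, hβa⟩ : ∃ a : ℝ → E3 × E3, ContDiffOn ℝ ∞ a (Ioi 0) ∧
      ∀ r, 0 < r → ∀ θ, β r θ = generatorShear (a r) r θ := by
    rcases hβ with hβ | hβ
    · have hinv : ContDiffOn ℝ ∞ (fun r : ℝ => r⁻¹) (Ioi 0) :=
        contDiffOn_id.inv fun r hr => (ne_of_gt hr : r ≠ 0)
      refine ⟨fun r => (r⁻¹ • s₁ r, r⁻¹ • t₁ r), (hinv.smul hs).prodMk (hinv.smul ht),
        fun r hr θ => ?_⟩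
      have e : angProj θ (r⁻¹ • t₁ r) = r⁻¹ • angProj θ (t₁ r) := by
        rw [angProj, angProj, real_inner_smul_right, smul_sub, smul_smul]
      rw [hβ, generatorShear, e, cross_smul_right, ← smul_add, smul_inv_smul₀ hr.ne']
    · exact ⟨fun r => (s₁ r, t₁ r), hs.prodMk ht, fun r _ θ => by
        rw [hβ, generatorShear, smul_add]⟩
  obtain ⟨w, R, z, q, h, hw, hR⟩ := exists_isLorentzCurve ha hr₀ w₀ hR₀
  have hpar : ∀ r, 0 < r → HasParametersAt (lorentzCurveMap w R) r (w r) (R r) := fun r hr =>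
    ⟨h.mem_rotation r hr, fun _ _ => rfl⟩
  refine ⟨lorentzCurveMap w R, w, R, h.isQuasiSphericalMap, h.smooth_boost, h.smooth_rotation, hpar,
    hw, hR, h.hasShear hβa, fun r hr w' R' h' => ?_, fun Ψ hΨ hΨp hΨs => ?_⟩
  · exact lorentz_parameters_unique hr fun θ hθ => (h'.2 θ hθ).symm.trans ((hpar r hr).2 θ hθ)
  · refine eqOn_of_hasShear ha hβa hΨ hΨs h.isQuasiSphericalMap (h.hasShear hβa) hr₀ fun θ hθ => ?_
    rw [hΨp.2 θ hθ, (hpar r₀ hr₀).2 θ hθ, hw, hR]
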